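/- All compact groups are Hausdorff, and morphisms of compact groups are continuous homomorphisms. Let $H$ be a compact group, let $(G_i)_{i\in I}$ be a finite family of compact groups, and let $\iota_i\colon H\to G_i$ be injective continuous homomorphisms whose images $\iota_i(H)$ are normal in $G_i$. Let $\coprod_{H,\mathrm{Gp}}G_i$ denote the pushout of the $\iota_i$ in the category of (abstract) groups (the free product of the $G_i$ amalgamated along $H$), and let $\coprod_{H}G_i$ denote their pushout in the category of compact groups. The family $(\iota_i)_{i\in I}$ is called algebraically sound if the canonical homomorphism $\coprod_{H,\mathrm{Gp}}G_i\to\coprod_{H}G_i$ is injective. Let $\mathrm{Aut}(H)$ be the group of continuous automorphisms of $H$ with the topology of uniform convergence, and for each $i$ let $\mathrm{Ad}_i\colon G_i\to\mathrm{Aut}(H)$ be the conjugation action, $\iota_i(\mathrm{Ad}_i(g)(h))=g\,\iota_i(h)\,g^{-1}$ for $g\in G_i$ and $h\in H$. Then $(\iota_i)_{i\in I}$ is algebraically sound if and only if there is a compact subgroup of $\mathrm{Aut}(H)$ that contains $\mathrm{Ad}_i(G_i)$ for every $i\in I$. In particular, if $\mathrm{Aut}(H)$ is compact, then $(\iota_i)_{i\in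 I}$ is algebraically sound. -/

import Mathlib

open Function Topology

universe u v w x

/-! ### The compact-group pushout of a family of morphisms with a common domain -/

section Pushout

variable {ι : Type w} {H : Type u} {G : ι → Type v}
  [Group H] [TopologicalSpace H]
  [∀ i, Group (G i)] [∀ i, TopologicalSpace (G i)]

/-- The group-theoretic (multi-)pushout of the `G i` over `H`: the free product of the groups
`G i` amalgamated along `H`. Topologies play no role in it. -/
abbrev AlgPushout (φ : ∀ i, H →ₜ* G i) : Type (max w v u) :=
  Monoid.PushoutI (fun i => (φ i : H →* G i))

/-- A compact Hausdorff group (living on a subset of a fixed large set) which receives a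
homomorphism from the group-theoretic pushout that is continuous on `H` and on every `G i`.
Up to isomorphism every compact group that is topologically generated by compatible images of `H`
and the `G i` occurs here, see `CompactPushout.exists_lift`. -/
structure CompactTarget (φ : ∀ i, H →ₜ* G i) where
  /-- the underlying set -/
  carrier : Set (Ultrafilter (AlgPushout φ))
  group : Group carrier
  topology : TopologicalSpace carrier
  isTopologicalGroup : IsTopologicalGroup carrier
  compactSpace : CompactSpace carrier
  t2Space : T2Space carrier
  /-- the homomorphism from the group-theoretic pushout -/
  hom : AlgPushout φ →* carrier
  continuous_hom_of : ∀ i, Continuous fun g : G i => hom (Monoid.PushoutI.of i g)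
  continuous_hom_base : Continuous fun h : H => hom (Monoid.PushoutI.base _ h)

namespace CompactTarget

variable {φ : ∀ i, H →ₜ* G i}

/-- The underlying type of a `CompactTarget`, carrying the structures recorded there. -/
def Carrier (c : CompactTarget φ) : Type (max w v u) := c.carrier

instance (c : CompactTarget φ) : Group c.Carrier := c.group
instance (c : CompactTarget φ) : TopologicalSpace c.Carrier := c.topology
instance (c : CompactTarget φ) : IsTopologicalGroup c.Carrier := c.isTopologicalGroup
instance (c : CompactTarget φ) : CompactSpace c.Carrier := c.compactSpace
instance (c : CompactTarget φ) : T2Space c.Carrier := c.t2Space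

/-- The homomorphism from the group-theoretic pushout. -/
def toCarrier (c : CompactTarget φ) : AlgPushout φ →* c.Carrier := c.hom

/-- The diagonal homomorphism to the product of all compact targets. -/
def diag (φ : ∀ i, H →ₜ* G i) : AlgPushout φ →* (∀ c : CompactTarget φ, c.Carrier) :=
  MonoidHom.pi fun c => c.toCarrier

end CompactTarget

/-- The pushout of the `G i` over `H` in the category of compact (Hausdorff) groups: the closure of
the image of the group-theoretic pushout in the product of all compact targets (the Bohr
compactification). Its universal property is `CompactPushout.exists_lift` together with
`CompactPushout.hom_ext`. -/
def CompactPushout (φ : ∀ i, H →ₜ* G i) : Type (max w v u) :=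
  (CompactTarget.diag φ).range.topologicalClosure

namespace CompactPushout

section Instances

variable (φ : ∀ i, H →ₜ* G i)

instance : Group (CompactPushout φ) :=
  inferInstanceAs (Group (CompactTarget.diag φ).range.topologicalClosure)

instance : TopologicalSpace (CompactPushout φ) :=
  inferInstanceAs (TopologicalSpace (CompactTarget.diag φ).range.topologicalClosure)

instance : IsTopologicalGroup (CompactPushout φ) :=
  inferInstanceAs (IsTopologicalGroup (CompactTarget.diag φ).range.topologicalClosure)

instance : CompactSpace (CompactPushout φ) :=
  isCompact_iff_compactSpace.mp
    (CompactTarget.diag φ).range.isClosed_topologicalClosure.isCompact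

instance : T2Space (CompactPushout φ) :=
  inferInstanceAs (T2Space (CompactTarget.diag φ).range.topologicalClosure)

end Instances

variable (φ : ∀ i, H →ₜ* G i)

/-- The diagonal homomorphism, with values in the closure of its range. -/
def diag : AlgPushout φ →* CompactPushout φ :=
  (CompactTarget.diag φ).codRestrict (CompactTarget.diag φ).range.topologicalClosure
    fun x => Subgroup.le_topologicalClosure _ ⟨x, rfl⟩

/-- The structure map `G i → ∐_H G i` of the compact-group pushout. -/
def of (i : ι) : G i →ₜ* CompactPushout φ where
  toMonoidHom := (diag φ).comp (Monoid.PushoutI.of i)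
  continuous_toFun := Continuous.subtype_mk (continuous_pi fun c => c.continuous_hom_of i) _

/-- The structure map `H → ∐_H G i` of the compact-group pushout. -/
def base : H →ₜ* CompactPushout φ where
  toMonoidHom := (diag φ).comp (Monoid.PushoutI.base _)
  continuous_toFun := Continuous.subtype_mk (continuous_pi fun c => c.continuous_hom_base) _

theorem of_comp (i : ι) : (of φ i).comp (φ i) = base φ := by
  ext h
  exact congrArg (diag φ)
    (Monoid.PushoutI.of_apply_eq_base (fun i => (φ i : H →* G i)) i h)

theorem of_comp_coe (i : ι) : (of φ i : G i →* CompactPushout φ).comp (φ i : H →* G i) =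
    (base φ : H →* CompactPushout φ) :=
  MonoidHom.ext fun h => DFunLike.congr_fun (of_comp φ i) h

/-- The canonical map from the group-theoretic pushout to the compact-group pushout, induced by the
structure maps of the latter. -/
def ofAlg : AlgPushout φ →* CompactPushout φ :=
  Monoid.PushoutI.lift (fun i => (of φ i : G i →* CompactPushout φ))
    (base φ : H →* CompactPushout φ)
    (of_comp_coe φ)

theorem ofAlg_eq_diag : ofAlg φ = diag φ := by
  refine Monoid.PushoutI.hom_ext (fun i => ?_) ?_
  · ext g
    exact Monoid.PushoutI.lift_of (φ := fun i => (φ i : H →* G i))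
      (fun i => (of φ i : G i →* CompactPushout φ)) (base φ : H →* CompactPushout φ)
      (of_comp_coe φ) g
  · ext h
    exact Monoid.PushoutI.lift_base (φ := fun i => (φ i : H →* G i))
      (fun i => (of φ i : G i →* CompactPushout φ)) (base φ : H →* CompactPushout φ)
      (of_comp_coe φ) h

theorem denseRange_ofAlg : DenseRange (ofAlg φ) := by
  rw [ofAlg_eq_diag]
  intro x
  apply (closure_subtype
    (p := (· ∈ (CompactTarget.diag φ).range.topologicalClosure)) (x := x) (s := Set.range (diag φ))).2
  refine closure_mono ?_ x.2
  rintro _ ⟨z, rfl⟩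
  exact ⟨_, ⟨z, rfl⟩, rfl⟩

variable {φ}

/-- Uniqueness in the universal property: continuous homomorphisms to a Hausdorff group are
determined by their restrictions to the `G i` and `H`. -/
theorem hom_ext {K : Type x} [Group K] [TopologicalSpace K] [T2Space K]
    {f g : CompactPushout φ →ₜ* K} (h : ∀ i, f.comp (of φ i) = g.comp (of φ i))
    (hbase : f.comp (base φ) = g.comp (base φ)) : f = g := by
  have key : (f : CompactPushout φ →* K).comp (ofAlg φ) =
      (g : CompactPushout φ →* K).comp (ofAlg φ) := by
    rw [ofAlg_eq_diag]
    refine Monoid.PushoutI.hom_ext (fun i => ?_) ?_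
    · ext y
      exact DFunLike.congr_fun (h i) y
    · ext y
      exact DFunLike.congr_fun hbase y
  refine DFunLike.coe_injective ((denseRange_ofAlg φ).equalizer f.continuous_toFun
    g.continuous_toFun ?_)
  funext y
  exact DFunLike.congr_fun key y

/-- Existence in the universal property: compatible continuous homomorphisms to a compact group (in
any universe) factor through the compact-group pushout. -/
theorem exists_lift {K : Type x} [Group K] [TopologicalSpace K] [IsTopologicalGroup K]
    [CompactSpace K] [T2Space K] (f : ∀ i, G i →ₜ* K) (k : H →ₜ* K)
    (hf : ∀ i, (f i).comp (φ i) = k) :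
    ∃ F : CompactPushout φ →ₜ* K, (∀ i, F.comp (of φ i) = f i) ∧ F.comp (base φ) = k := by
  classical
  let p : AlgPushout φ →* K :=
    Monoid.PushoutI.lift (fun i => (f i : G i →* K)) (k : H →* K)
      fun i => MonoidHom.ext fun h => DFunLike.congr_fun (hf i) h
  have p_of : ∀ i (g : G i), p (Monoid.PushoutI.of i g) = f i g :=
    fun i g => Monoid.PushoutI.lift_of _ _ _ g
  have p_base : ∀ h : H, p (Monoid.PushoutI.base _ h) = k h :=
    fun h => Monoid.PushoutI.lift_base _ _ _ h
  let L : Subgroup K := p.range.topologicalClosure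
  have : CompactSpace L :=
    isCompact_iff_compactSpace.mp p.range.isClosed_topologicalClosure.isCompact
  -- points of `L` are limits of ultrafilters on the algebraic pushout
  have hlim : ∀ y : L, ∃ F : Ultrafilter (AlgPushout φ), Filter.Tendsto p F (𝓝 (y : K)) := by
    intro y
    have hy : (y : K) ∈ closure (Set.range p) := y.2
    have hne : (Filter.comap p (𝓝 (y : K))).NeBot := by
      rw [Filter.comap_neBot_iff_frequently]
      exact mem_closure_iff_frequently.1 hy
    exact ⟨Ultrafilter.of (Filter.comap p (𝓝 (y : K))),
      Filter.tendsto_iff_comap.2 (Ultrafilter.of_le _)⟩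
  choose s hs using hlim
  have s_inj : Injective s := fun y z hyz => by
    refine Subtype.ext (tendsto_nhds_unique (hs y) ?_)
    rw [hyz]
    exact hs z
  let e : L ≃ Set.range s := Equiv.ofInjective s s_inj
  let gr : Group (Set.range s) := e.symm.group
  let tp : TopologicalSpace (Set.range s) := TopologicalSpace.induced e.symm inferInstance
  let em : Set.range s ≃* L := e.symm.mulEquiv
  let eh : Set.range s ≃ₜ L := e.symm.toHomeomorphOfIsInducing ⟨rfl⟩
  let q : AlgPushout φ →* L :=
    p.codRestrict L fun x => Subgroup.le_topologicalClosure _ ⟨x, rfl⟩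
  let c : CompactTarget φ :=
    { carrier := Set.range s
      group := gr
      topology := tp
      isTopologicalGroup := topologicalGroup_induced em
      compactSpace := eh.symm.compactSpace
      t2Space := eh.symm.t2Space
      hom := em.symm.toMonoidHom.comp q
      continuous_hom_of := fun i => by
        refine eh.symm.continuous.comp (Continuous.subtype_mk ?_ _)
        simp only [p_of]
        exact (f i).continuous_toFun
      continuous_hom_base := by
        refine eh.symm.continuous.comp (Continuous.subtype_mk ?_ _)
        simp only [p_base]
        exact k.continuous_toFun }
  let r : c.Carrier →* K := L.subtype.comp em.toMonoidHom
  have hr : Continuous r := continuous_subtype_val.comp eh.continuous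
  have hrq : ∀ y, r (c.toCarrier y) = p y := fun y =>
    congrArg Subtype.val (em.apply_symm_apply (q y))
  let pr : CompactPushout φ →* c.Carrier :=
    (Pi.evalMonoidHom (fun c : CompactTarget φ => c.Carrier) c).comp
      (Subgroup.subtype (CompactTarget.diag φ).range.topologicalClosure)
  have hpr : Continuous pr := (continuous_apply c).comp continuous_subtype_val
  refine ⟨⟨r.comp pr, hr.comp hpr⟩, fun i => ?_, ?_⟩
  · ext g
    exact (hrq _).trans (p_of i g)
  · ext h
    exact (hrq _).trans (p_base h)

end CompactPushout

/-- A family of morphisms `H → G i` of compact groups is *algebraically sound* if the canonical map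
from the group-theoretic pushout to the compact-group pushout is one-to-one. -/
def AlgebraicallySound (φ : ∀ i, H →ₜ* G i) : Prop :=
  Injective (CompactPushout.ofAlg φ)

end Pushout

/-! ### The topological automorphism group -/

/-- The group of automorphisms of the topological group `H`
(with composition as multiplication). -/
def ContAut (H : Type u) [Group H] [TopologicalSpace H] : Type u := H ≃ₜ* H

namespace ContAut

section

variable {H : Type u} [Group H] [TopologicalSpace H]

instance : EquivLike (ContAut H) H H := inferInstanceAs (EquivLike (H ≃ₜ* H) H H)
instance : MulEquivClass (ContAut H) H H := inferInstanceAs (MulEquivClass (H ≃ₜ* H) H H)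
instance : HomeomorphClass (ContAut H) H H := inferInstanceAs (HomeomorphClass (H ≃ₜ* H) H H)

instance : Group (ContAut H) where
  mul a b := ContinuousMulEquiv.trans b a
  one := ContinuousMulEquiv.refl H
  inv a := ContinuousMulEquiv.symm a
  mul_assoc _ _ _ := rfl
  one_mul _ := rfl
  mul_one _ := rfl
  inv_mul_cancel a := ContinuousMulEquiv.self_trans_symm a

@[ext]
theorem ext {a b : ContAut H} (h : ∀ y, a y = b y) : a = b := DFunLike.ext a b h

@[simp]
theorem mul_apply (a b : ContAut H) (y : H) : (a * b) y = a (b y) := rfl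

@[simp]
theorem one_apply (y : H) : (1 : ContAut H) y = y := rfl

/-- The uniform topology on the automorphism group, i.e. the topology of uniform convergence
with respect to the uniform structure of the group `H`. -/
instance uniformTopology [IsTopologicalGroup H] : TopologicalSpace (ContAut H) :=
  letI := IsTopologicalGroup.rightUniformSpace H
  TopologicalSpace.induced (fun a : ContAut H => UniformFun.ofFun (a : H → H)) inferInstance

/-- For compact `H` the uniform topology is also the compact-open topology. -/
theorem uniformTopology_eq_compactOpen [IsTopologicalGroup H] [CompactSpace H] :
    (uniformTopology : TopologicalSpace (ContAut H)) =
      TopologicalSpace.induced (fun a : ContAut H => (⟨a, map_continuous a⟩ : C(H, H)))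
        inferInstance := by
  let := IsTopologicalGroup.rightUniformSpace H
  have h := (ContinuousMap.isUniformEmbedding_uniformFunOfFun
    (α := H) (β := H)).isEmbedding.isInducing.eq_induced
  refine Eq.trans ?_ (congrArg (TopologicalSpace.induced
    fun a : ContAut H => (⟨a, map_continuous a⟩ : C(H, H))) h.symm)
  rw [induced_compose]
  rfl

end

end ContAut

/-! ### Conjugation along a normal embedding -/

section Conj

variable {H : Type u} {G : Type v}
  [Group H] [TopologicalSpace H] [CompactSpace H]
  [Group G] [TopologicalSpace G] [IsTopologicalGroup G] [T2Space G]

theorem exists_conjAut (φ : H →ₜ* G) (hinj : Injective φ) (hnormal : (φ : H →* G).range.Normal)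
    (g : G) : ∃ a : ContAut H, ∀ h, φ (a h) = g * φ h * g⁻¹ := by
  have hemb : IsClosedEmbedding φ := φ.continuous_toFun.isClosedEmbedding hinj
  have hex : ∀ (g : G) (h : H), ∃ h', φ h' = g * φ h * g⁻¹ := fun g h =>
    hnormal.conj_mem (φ h) ⟨h, rfl⟩ g
  choose c hc using hex
  have hcont : ∀ g, Continuous (c g) := fun g => by
    rw [hemb.isInducing.continuous_iff]
    have : φ ∘ c g = fun h => g * φ h * g⁻¹ := funext (hc g)
    rw [this]
    exact (continuous_const.mul φ.continuous_toFun).mul continuous_const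
  have hinv : ∀ g h, c g⁻¹ (c g h) = h := fun g h => hinj (by rw [hc, hc]; group)
  have hinv' : ∀ g h, c g (c g⁻¹ h) = h := fun g h => hinj (by rw [hc, hc]; group)
  have hmul : ∀ a b, c g (a * b) = c g a * c g b := fun a b =>
    hinj (by rw [hc, map_mul, map_mul, hc, hc]; group)
  let e : H ≃ₜ* H :=
    { toFun := c g
      invFun := c g⁻¹
      left_inv := hinv g
      right_inv := hinv' g
      map_mul' := hmul
      continuous_toFun := hcont g
      continuous_invFun := hcont g⁻¹ }
  exact ⟨e, hc g⟩

/-- The conjugation morphism `G → Aut(H)` of a normal embedding `φ : H → G` of compact groups: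
`g` acts on `H` by the automorphism `h ↦ φ⁻¹(g φ(h) g⁻¹)`, see `apply_conjAut`. -/
noncomputable def conjAut (φ : H →ₜ* G) (hinj : Injective φ)
    (hnormal : (φ : H →* G).range.Normal) : G →* ContAut H where
  toFun g := (exists_conjAut φ hinj hnormal g).choose
  map_one' := by
    ext h
    apply hinj
    rw [(exists_conjAut φ hinj hnormal 1).choose_spec h]
    simp
  map_mul' a b := by
    ext h
    apply hinj
    rw [(exists_conjAut φ hinj hnormal (a * b)).choose_spec h, ContAut.mul_apply,
      (exists_conjAut φ hinj hnormal a).choose_spec,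
      (exists_conjAut φ hinj hnormal b).choose_spec]
    group

theorem apply_conjAut (φ : H →ₜ* G) (hinj : Injective φ) (hnormal : (φ : H →* G).range.Normal)
    (g : G) (h : H) : φ (conjAut φ hinj hnormal g h) = g * φ h * g⁻¹ :=
  (exists_conjAut φ hinj hnormal g).choose_spec h

end Conj

/-! ### Finite-dimensional orthogonal representations -/

/-- A finite-dimensional real orthogonal representation of a group. -/
structure OrthRep (Γ : Type*) [Group Γ] where
  /-- the underlying space -/
  V : Type
  [normed : NormedAddCommGroup V]
  [innerProduct : InnerProductSpace ℝ V]
  [finiteDimensional : FiniteDimensional ℝ V]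
  /-- the action -/
  ρ : Γ →* (V ≃ₗᵢ[ℝ] V)

namespace OrthRep

attribute [instance] normed innerProduct finiteDimensional

variable {Γ : Type*} [Group Γ] {Δ : Type*} [Group Δ]

theorem ρ_mul_apply (R : OrthRep Γ) (g h : Γ) (v : R.V) : R.ρ (g * h) v = R.ρ g (R.ρ h v) := by
  rw [map_mul]; rfl

theorem ρ_one_apply (R : OrthRep Γ) (v : R.V) : R.ρ 1 v = v := by
  rw [map_one]; rfl

theorem ρ_inv_apply_self (R : OrthRep Γ) (g : Γ) (v : R.V) : R.ρ g⁻¹ (R.ρ g v) = v := by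
  rw [← ρ_mul_apply, inv_mul_cancel, ρ_one_apply]

theorem ρ_apply_inv_self (R : OrthRep Γ) (g : Γ) (v : R.V) : R.ρ g (R.ρ g⁻¹ v) = v := by
  rw [← ρ_mul_apply, mul_inv_cancel, ρ_one_apply]

theorem inner_ρ_left (R : OrthRep Γ) (g : Γ) (v w : R.V) :
    inner ℝ (R.ρ g v) w = inner ℝ v (R.ρ g⁻¹ w) := by
  rw [← (R.ρ g).inner_map_map v, ρ_apply_inv_self]

/-- Strong continuity of a representation. -/
def IsContinuous [TopologicalSpace Γ] (R : OrthRep Γ) : Prop := ∀ v, Continuous fun g => R.ρ g v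

/-- Restriction of a representation along a homomorphism. -/
def comap (f : Δ →* Γ) (R : OrthRep Γ) : OrthRep Δ := ⟨R.V, R.ρ.comp f⟩

/-- A subspace stable under the action. -/
def IsInvariant (R : OrthRep Γ) (U : Submodule ℝ R.V) : Prop := ∀ g, ∀ u ∈ U, R.ρ g u ∈ U

theorem IsInvariant.orthogonal {R : OrthRep Γ} {U : Submodule ℝ R.V} (hU : R.IsInvariant U) :
    R.IsInvariant Uᗮ := by
  intro g u hu w hw
  rw [real_inner_comm, inner_ρ_left, real_inner_comm]
  exact hu _ (hU _ _ hw)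

/-- The subrepresentation on an invariant subspace. -/
noncomputable def sub (R : OrthRep Γ) (U : Submodule ℝ R.V) (hU : R.IsInvariant U) : OrthRep Γ where
  V := U
  ρ :=
    { toFun := fun g =>
        { toFun := fun u => ⟨R.ρ g u, hU g u u.2⟩
          invFun := fun u => ⟨R.ρ g⁻¹ u, hU g⁻¹ u u.2⟩
          map_add' := fun u v => Subtype.ext (map_add (R.ρ g) (u : R.V) v)
          map_smul' := fun c u => Subtype.ext (map_smul (R.ρ g) c (u : R.V))
          left_inv := fun u => Subtype.ext (R.ρ_inv_apply_self g u)
          right_inv := fun u => Subtype.ext (R.ρ_apply_inv_self g u)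
          norm_map' := fun u => (R.ρ g).norm_map u }
      map_one' := by ext u; exact R.ρ_one_apply u
      map_mul' := fun g h => by ext u; exact R.ρ_mul_apply g h u }

/-- The orthogonal direct sum of two representations. -/
noncomputable def prod (R R' : OrthRep Γ) : OrthRep Γ where
  V := WithLp 2 (R.V × R'.V)
  ρ :=
    { toFun := fun g => LinearIsometryEquiv.withLpProdCongr 2 (R.ρ g) (R'.ρ g)
      map_one' := by simp only [map_one]; rfl
      map_mul' := fun g h => by simp only [map_mul]; rfl }

/-- Isometric equivalence of representations. -/
def Equivalent (R R' : OrthRep Γ) : Prop :=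
  ∃ u : R.V ≃ₗᵢ[ℝ] R'.V, ∀ g v, u (R.ρ g v) = R'.ρ g (u v)

theorem Equivalent.symm {R R' : OrthRep Γ} : R.Equivalent R' → R'.Equivalent R := by
  rintro ⟨u, hu⟩
  refine ⟨u.symm, fun g v => ?_⟩
  rw [LinearIsometryEquiv.symm_apply_eq, hu, LinearIsometryEquiv.apply_symm_apply]

theorem Equivalent.trans {R R' R'' : OrthRep Γ} :
    R.Equivalent R' → R'.Equivalent R'' → R.Equivalent R'' := by
  rintro ⟨u, hu⟩ ⟨w, hw⟩
  refine ⟨u.trans w, fun g v => ?_⟩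
  simp only [LinearIsometryEquiv.trans_apply, hu, hw]

theorem Equivalent.prod {R R' S S' : OrthRep Γ} :
    R.Equivalent R' → S.Equivalent S' → (R.prod S).Equivalent (R'.prod S') := by
  rintro ⟨u, hu⟩ ⟨w, hw⟩
  refine ⟨LinearIsometryEquiv.withLpProdCongr 2 u w, fun g v => ?_⟩
  exact congrArg (WithLp.toLp 2) (Prod.ext (hu g v.fst) (hw g v.snd))

theorem equivalent_prod_orthogonal (R : OrthRep Γ) (U : Submodule ℝ R.V) (hU : R.IsInvariant U) :
    R.Equivalent ((R.sub U hU).prod (R.sub Uᗮ hU.orthogonal)) := by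
  refine Equivalent.symm ⟨(U.orthogonalDecomposition).symm, fun g v => ?_⟩
  erw [Submodule.orthogonalDecomposition_symm_apply, Submodule.orthogonalDecomposition_symm_apply]
  exact (map_add (R.ρ g) (U.subtype v.fst) (Uᗮ.subtype v.snd)).symm

/-- The space of intertwining operators. -/
def hom (S R : OrthRep Γ) : Submodule ℝ (S.V →ₗ[ℝ] R.V) where
  carrier := {f | ∀ g v, f (S.ρ g v) = R.ρ g (f v)}
  add_mem' {f f'} hf hf' g v := by simp only [LinearMap.add_apply, map_add, hf g v, hf' g v]
  zero_mem' g v := by simp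
  smul_mem' c f hf g v := by simp only [LinearMap.smul_apply, map_smul, hf g v]

/-- The dimension of the space of intertwining operators. -/
noncomputable def mult (S R : OrthRep Γ) : ℕ := Module.finrank ℝ (hom S R)

theorem mult_ne_zero_iff {S R : OrthRep Γ} : mult S R ≠ 0 ↔ ∃ f ∈ hom S R, f ≠ 0 := by
  rw [mult, Ne, Submodule.finrank_eq_zero, ← Ne, Submodule.ne_bot_iff]

theorem mult_eq_of_equivalent (S : OrthRep Γ) {R R' : OrthRep Γ} (h : R.Equivalent R') :
    mult S R = mult S R' := by
  obtain ⟨u, hu⟩ := h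
  refine LinearEquiv.finrank_eq (R := ℝ)
    { toFun := fun f => ⟨u.toLinearEquiv.toLinearMap ∘ₗ f.1, fun g v =>
        (congrArg u (f.2 g v)).trans (hu g _)⟩
      invFun := fun f => ⟨u.symm.toLinearEquiv.toLinearMap ∘ₗ f.1, fun g v => by
        change u.symm (f.1 _) = R.ρ g (u.symm (f.1 v))
        rw [LinearIsometryEquiv.symm_apply_eq, hu, f.2 g v, LinearIsometryEquiv.apply_symm_apply]⟩
      map_add' := fun f f' => by ext v; exact map_add u _ _
      map_smul' := fun c f => by ext v; exact map_smul u c _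
      left_inv := fun f => by ext v; exact u.symm_apply_apply _
      right_inv := fun f => by ext v; exact u.apply_symm_apply _ }

theorem mult_prod (S R R' : OrthRep Γ) : mult S (R.prod R') = mult S R + mult S R' := by
  rw [mult, mult, mult, ← Module.finrank_prod]
  let e : (R.prod R').V ≃ₗ[ℝ] R.V × R'.V := WithLp.linearEquiv 2 ℝ (R.V × R'.V)
  refine LinearEquiv.finrank_eq (R := ℝ)
    { toFun := fun f =>
        (⟨LinearMap.fst ℝ R.V R'.V ∘ₗ e.toLinearMap ∘ₗ f.1, fun g v =>
            congrArg (fun x => (e x).1) (f.2 g v)⟩,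
          ⟨LinearMap.snd ℝ R.V R'.V ∘ₗ e.toLinearMap ∘ₗ f.1, fun g v =>
            congrArg (fun x => (e x).2) (f.2 g v)⟩)
      invFun := fun f => ⟨e.symm.toLinearMap ∘ₗ (f.1.1.prod f.2.1), fun g v => by
        exact congrArg e.symm (Prod.ext (f.1.2 g v) (f.2.2 g v))⟩
      map_add' := fun f f' => rfl
      map_smul' := fun c f => rfl
      left_inv := fun f => rfl
      right_inv := fun f => rfl }

theorem mult_eq_zero_of_subsingleton (S R : OrthRep Γ) [Subsingleton R.V] : mult S R = 0 := by
  by_contra h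
  obtain ⟨f, -, hf⟩ := mult_ne_zero_iff.1 h
  exact hf (LinearMap.ext fun v => Subsingleton.elim _ _)

theorem adjoint_mem_hom {S R : OrthRep Γ} {f : S.V →ₗ[ℝ] R.V} (hf : f ∈ hom S R) :
    LinearMap.adjoint f ∈ hom R S := by
  intro g v
  refine ext_inner_right ℝ fun w => ?_
  rw [LinearMap.adjoint_inner_left, inner_ρ_left, inner_ρ_left, LinearMap.adjoint_inner_left, hf]

theorem comp_mem_hom {S R T : OrthRep Γ} {f : S.V →ₗ[ℝ] R.V} {f' : R.V →ₗ[ℝ] T.V}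
    (hf : f ∈ hom S R) (hf' : f' ∈ hom R T) : f' ∘ₗ f ∈ hom S T := fun g v => by
  rw [LinearMap.comp_apply, hf, hf', LinearMap.comp_apply]

theorem mult_ne_zero_comm {S R : OrthRep Γ} (h : mult S R ≠ 0) : mult R S ≠ 0 := by
  obtain ⟨f, hf, hf0⟩ := mult_ne_zero_iff.1 h
  refine mult_ne_zero_iff.2 ⟨_, adjoint_mem_hom hf, fun h0 => hf0 ?_⟩
  rw [← LinearMap.adjoint_adjoint f, h0, map_zero]

/-- Irreducibility of a representation. -/
def IsIrreducible (R : OrthRep Γ) : Prop :=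
  Nontrivial R.V ∧ ∀ U, R.IsInvariant U → U = ⊥ ∨ U = ⊤

theorem isIrreducible_sub {R : OrthRep Γ} {U : Submodule ℝ R.V} (hU : R.IsInvariant U)
    (h0 : U ≠ ⊥) (h : ∀ U' ≤ U, R.IsInvariant U' → U' ≠ ⊥ → U' = U) :
    (R.sub U hU).IsIrreducible := by
  refine ⟨Submodule.nontrivial_iff_ne_bot.2 h0, fun (W : Submodule ℝ U) hW => ?_⟩
  by_cases hW0 : W = ⊥
  · exact Or.inl hW0
  right
  have hmap : W.map U.subtype = U := by
    refine h _ (Submodule.map_subtype_le U W) ?_ ?_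
    · rintro g _ ⟨w, hw, rfl⟩
      exact ⟨_, hW g w hw, rfl⟩
    · exact fun h => hW0 (Submodule.map_injective_of_injective U.subtype_injective
        (h.trans (Submodule.map_bot _).symm))
  apply Submodule.map_injective_of_injective U.subtype_injective
  change W.map U.subtype = Submodule.map U.subtype ⊤
  rw [hmap, Submodule.map_subtype_top]

theorem exists_isIrreducible_sub (R : OrthRep Γ) {U : Submodule ℝ R.V} (hU : R.IsInvariant U)
    (h0 : U ≠ ⊥) : ∃ S : Submodule ℝ R.V, ∃ hS : R.IsInvariant S, S ≤ U ∧ S ≠ ⊥ ∧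
      (R.sub S hS).IsIrreducible := by
  obtain ⟨S, hSU, hS⟩ := exists_minimal_le_of_wellFoundedLT
    (fun U : Submodule ℝ R.V => R.IsInvariant U ∧ U ≠ ⊥) U ⟨hU, h0⟩
  exact ⟨S, hS.1.1, hSU, hS.1.2, isIrreducible_sub hS.1.1 hS.1.2
    fun U' hle hinv hne => le_antisymm hle (hS.2 ⟨hinv, hne⟩ hle)⟩

theorem subtype_mem_hom (R : OrthRep Γ) (U : Submodule ℝ R.V) (hU : R.IsInvariant U) :
    (U.subtype : (R.sub U hU).V →ₗ[ℝ] R.V) ∈ hom (R.sub U hU) R := fun _ _ => rfl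

theorem mult_sub_ne_zero (R : OrthRep Γ) (U : Submodule ℝ R.V) (hU : R.IsInvariant U)
    (h0 : U ≠ ⊥) : mult (R.sub U hU) R ≠ 0 := by
  refine mult_ne_zero_iff.2 ⟨_, subtype_mem_hom R U hU, fun h => h0 ?_⟩
  rw [Submodule.eq_bot_iff]
  intro x hx
  exact congrArg (fun f => f ⟨x, hx⟩) h

theorem range_isInvariant {S R : OrthRep Γ} {f : S.V →ₗ[ℝ] R.V} (hf : f ∈ hom S R) :
    R.IsInvariant (LinearMap.range f) := by
  rintro g _ ⟨v, rfl⟩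
  exact ⟨S.ρ g v, hf g v⟩

/-- A nonzero intertwining operator on an irreducible representation is a multiple of an
isometry. -/
theorem IsIrreducible.exists_isometry {S R : OrthRep Γ} (hS : S.IsIrreducible)
    (h : mult S R ≠ 0) : ∃ u : S.V →ₗᵢ[ℝ] R.V, ∀ g v, u (S.ρ g v) = R.ρ g (u v) := by
  obtain ⟨f, hf, hf0⟩ := mult_ne_zero_iff.1 h
  have := hS.1
  let A : S.V →ₗ[ℝ] S.V := LinearMap.adjoint f ∘ₗ f
  have hA : A ∈ hom S S := comp_mem_hom hf (adjoint_mem_hom hf)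
  have hsymm : A.IsSymmetric := fun v w => by
    simp only [A, LinearMap.comp_apply, LinearMap.adjoint_inner_left, LinearMap.adjoint_inner_right]
  obtain ⟨c, hc⟩ : ∃ c, Module.End.HasEigenvalue A c :=
    ⟨_, hsymm.hasEigenvalue_iSup_of_finiteDimensional⟩
  have htop : Module.End.eigenspace A c = ⊤ := by
    refine (hS.2 _ fun g v hv => ?_).resolve_left hc
    rw [Module.End.mem_eigenspace_iff] at hv ⊢
    rw [hA, hv, map_smul]
  have hnorm : ∀ v, ‖f v‖ ^ 2 = c * ‖v‖ ^ 2 := fun v => by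
    have hv : v ∈ Module.End.eigenspace A c := htop ▸ Submodule.mem_top
    rw [Module.End.mem_eigenspace_iff] at hv
    rw [← real_inner_self_eq_norm_sq, ← LinearMap.adjoint_inner_right]
    change inner ℝ v (A v) = _
    rw [hv, inner_smul_right, real_inner_self_eq_norm_sq]
  have hcpos : 0 < c := by
    obtain ⟨v, hv⟩ : ∃ v, f v ≠ 0 := by
      by_contra! h0
      exact hf0 (LinearMap.ext h0)
    have h1 : 0 < c * ‖v‖ ^ 2 := by rw [← hnorm]; positivity
    exact pos_of_mul_pos_left h1 (by positivity)
  refine ⟨⟨(√c)⁻¹ • f, fun v => ?_⟩, fun g v => ?_⟩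
  · rw [LinearMap.smul_apply, norm_smul, ← sq_eq_sq₀ (by positivity) (by positivity), mul_pow,
      hnorm, Real.norm_eq_abs, sq_abs, inv_pow, Real.sq_sqrt hcpos.le]
    field_simp
  · exact (hom S R).smul_mem (√c)⁻¹ hf g v

/-- Representations with the same multiplicities are equivalent. -/
theorem equivalent_of_mult_eq (R R' : OrthRep Γ)
    (h : ∀ T : OrthRep Γ, T.IsIrreducible → mult T R = mult T R') : R.Equivalent R' := by
  induction hn : Module.finrank ℝ R.V using Nat.strong_induction_on generalizing R R' with
  | _ n ih =>
  by_cases hR : Subsingleton R.V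
  · have hR' : Subsingleton R'.V := by
      by_contra hne
      rw [not_subsingleton_iff_nontrivial] at hne
      obtain ⟨S, hS, -, hS0, hirr⟩ := R'.exists_isIrreducible_sub (U := ⊤)
        (fun _ _ _ => Submodule.mem_top) top_ne_bot
      have := R'.mult_sub_ne_zero S hS hS0
      rw [← h _ hirr] at this
      exact this (mult_eq_zero_of_subsingleton _ _)
    exact ⟨⟨0, fun v => by simp [Subsingleton.elim v 0]⟩, fun g v => Subsingleton.elim _ _⟩
  rw [not_subsingleton_iff_nontrivial] at hR
  obtain ⟨S, hS, -, hS0, hirr⟩ := R.exists_isIrreducible_sub (U := ⊤)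
    (fun _ _ _ => Submodule.mem_top) top_ne_bot
  have hm := R.mult_sub_ne_zero S hS hS0
  rw [h _ hirr] at hm
  obtain ⟨u, hu⟩ := hirr.exists_isometry hm
  let S' : Submodule ℝ R'.V := LinearMap.range u.toLinearMap
  have hS' : R'.IsInvariant S' := range_isInvariant (S := R.sub S hS) hu
  have hSS' : (R.sub S hS).Equivalent (R'.sub S' hS') :=
    ⟨u.equivRange, fun g v => Subtype.ext (hu g v)⟩
  have e1 := R.equivalent_prod_orthogonal S hS
  have e2 := R'.equivalent_prod_orthogonal S' hS'
  have hlt : Module.finrank ℝ (R.sub Sᗮ hS.orthogonal).V < n := by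
    have h1 := S.finrank_add_finrank_orthogonal
    have h2 : Module.finrank ℝ S ≠ 0 := by rwa [Ne, Submodule.finrank_eq_zero]
    change Module.finrank ℝ Sᗮ < n
    omega
  have e3 := ih _ hlt (R.sub Sᗮ hS.orthogonal) (R'.sub S'ᗮ hS'.orthogonal) (fun T hT => by
    have := h T hT
    rw [mult_eq_of_equivalent T e1, mult_eq_of_equivalent T e2, mult_prod, mult_prod,
      mult_eq_of_equivalent T hSS'] at this
    omega) rfl
  exact e1.trans ((hSS'.prod e3).trans e2.symm)

/-! ### Covariant pairs -/

section Covariant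

variable {c : Δ → Γ → Γ}

/-- The operators `α g` normalize the representation `R` and act on it through `c`. -/
def IsCovariant (c : Δ → Γ → Γ) (R : OrthRep Γ) (α : Δ →* (R.V ≃ₗᵢ[ℝ] R.V)) : Prop :=
  ∀ g h v, α g (R.ρ h v) = R.ρ (c g h) (α g v)

theorem exists_twist (hc : ∀ g, Surjective (c g)) {R : OrthRep Γ} {α : Δ →* (R.V ≃ₗᵢ[ℝ] R.V)}
    (hα : IsCovariant c R α)
    (hirr : ∀ U, R.IsInvariant U → (∀ g, ∀ u ∈ U, α g u ∈ U) → U = ⊥ ∨ U = ⊤)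
    {S T : OrthRep Γ} (hS : S.IsIrreducible) (hT : T.IsIrreducible)
    (hSR : mult S R ≠ 0) (hTR : mult T R ≠ 0) :
    ∃ g, ∃ u : S.V ≃ₗ[ℝ] T.V, ∀ h v, u (S.ρ h v) = T.ρ (c g h) (u v) := by
  obtain ⟨s, hs, hs0⟩ := mult_ne_zero_iff.1 hSR
  obtain ⟨f, hf, hf0⟩ := mult_ne_zero_iff.1 (mult_ne_zero_comm hTR)
  let W : Δ → Submodule ℝ R.V := fun g => (LinearMap.range s).map (α g).toLinearEquiv.toLinearMap
  have hWα : ∀ g, ∀ u ∈ ⨆ g, W g, α g u ∈ ⨆ g, W g := by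
    intro g u hu
    have hle : (⨆ g, W g) ≤ (⨆ g, W g).comap (α g).toLinearEquiv.toLinearMap := by
      refine iSup_le fun k => ?_
      rintro _ ⟨x, hx, rfl⟩
      refine Submodule.mem_iSup_of_mem (g * k) ⟨x, hx, ?_⟩
      rw [map_mul]; rfl
    exact hle hu
  have hWR : R.IsInvariant (⨆ g, W g) := by
    intro h u hu
    have hle : (⨆ g, W g) ≤ (⨆ g, W g).comap (R.ρ h).toLinearEquiv.toLinearMap := by
      refine iSup_le fun k => ?_
      rintro _ ⟨x, ⟨y, rfl⟩, rfl⟩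
      obtain ⟨h', rfl⟩ := hc k h
      refine Submodule.mem_iSup_of_mem k ⟨R.ρ h' (s y), ⟨S.ρ h' y, hs _ _⟩, ?_⟩
      exact hα k h' (s y)
    exact hle hu
  have htop : (⨆ g, W g) = ⊤ := by
    refine (hirr _ hWR hWα).resolve_left fun hbot => hs0 ?_
    ext v
    have : α 1 (s v) ∈ ⨆ g, W g := Submodule.mem_iSup_of_mem 1 ⟨s v, ⟨v, rfl⟩, rfl⟩
    rw [hbot, Submodule.mem_bot] at this
    rwa [map_one] at this
  obtain ⟨g, hg⟩ : ∃ g, f ∘ₗ (α g).toLinearEquiv.toLinearMap ∘ₗ s ≠ 0 := by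
    by_contra! h0
    apply hf0
    have : (⨆ g, W g) ≤ LinearMap.ker f := by
      refine iSup_le fun k => ?_
      rintro _ ⟨x, ⟨y, rfl⟩, rfl⟩
      exact congrArg (fun f => f y) (h0 k)
    rwa [htop, top_le_iff, LinearMap.ker_eq_top] at this
  set u : S.V →ₗ[ℝ] T.V := f ∘ₗ (α g).toLinearEquiv.toLinearMap ∘ₗ s with hu
  have hequiv : ∀ h v, u (S.ρ h v) = T.ρ (c g h) (u v) := fun h v => by
    change f (α g (s (S.ρ h v))) = T.ρ (c g h) (f (α g (s v)))
    rw [hs, hα, hf]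
  have hinj : LinearMap.ker u = ⊥ := by
    refine (hS.2 _ fun h v hv => ?_).resolve_right fun h => hg (LinearMap.ker_eq_top.1 h)
    rw [LinearMap.mem_ker] at hv ⊢
    rw [hequiv, hv, map_zero]
  have hsurj : LinearMap.range u = ⊤ := by
    refine (hT.2 _ ?_).resolve_left fun h => hg (LinearMap.range_eq_bot.1 h)
    rintro h _ ⟨v, rfl⟩
    obtain ⟨h', rfl⟩ := hc g h
    exact ⟨S.ρ h' v, hequiv h' v⟩
  exact ⟨g, LinearEquiv.ofBijective u ⟨LinearMap.ker_eq_bot.1 hinj, LinearMap.range_eq_top.1 hsurj⟩,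
    hequiv⟩

theorem mult_eq_of_twist {R : OrthRep Γ} {α : Δ →* (R.V ≃ₗᵢ[ℝ] R.V)} (hα : IsCovariant c R α)
    {S T : OrthRep Γ} (g : Δ) (hc : Surjective (c g)) (u : S.V ≃ₗ[ℝ] T.V)
    (hu : ∀ h v, u (S.ρ h v) = T.ρ (c g h) (u v)) :
    mult T R = mult S R := by
  have hα' : ∀ h v, (α g).symm (R.ρ (c g h) v) = R.ρ h ((α g).symm v) := fun h v => by
    rw [LinearIsometryEquiv.symm_apply_eq, hα, LinearIsometryEquiv.apply_symm_apply]
  have hu' : ∀ h v, u.symm (T.ρ (c g h) v) = S.ρ h (u.symm v) := fun h v => by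
    rw [LinearEquiv.symm_apply_eq, hu, LinearEquiv.apply_symm_apply]
  refine LinearEquiv.finrank_eq (R := ℝ)
    { toFun := fun f => ⟨(α g).symm.toLinearEquiv.toLinearMap ∘ₗ f.1 ∘ₗ u.toLinearMap, fun h v => by
        change (α g).symm (f.1 (u (S.ρ h v))) = R.ρ h ((α g).symm (f.1 (u v)))
        rw [hu, f.2, hα']⟩
      invFun := fun f => ⟨(α g).toLinearEquiv.toLinearMap ∘ₗ f.1 ∘ₗ u.symm.toLinearMap, fun h v => by
        obtain ⟨h', rfl⟩ := hc h
        change (α g) (f.1 (u.symm (T.ρ (c g h') v))) = R.ρ (c g h') ((α g) (f.1 (u.symm v)))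
        rw [hu', f.2, hα]⟩
      map_add' := fun f f' => by ext v; exact map_add (α g).symm _ _
      map_smul' := fun r f => by ext v; exact map_smul (α g).symm r _
      left_inv := fun f => by
        ext v
        change (α g) ((α g).symm (f.1 (u (u.symm v)))) = f.1 v
        simp
      right_inv := fun f => by
        ext v
        change (α g).symm ((α g) (f.1 (u.symm (u v)))) = f.1 v
        simp }

/-- Irreducible covariant pairs with a common irreducible constituent have proportional
multiplicities. -/
theorem mult_mul_mult_eq (hc : ∀ g, Surjective (c g))
    {R : OrthRep Γ} {α : Δ →* (R.V ≃ₗᵢ[ℝ] R.V)} (hα : IsCovariant c R α)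
    (hirr : ∀ U, R.IsInvariant U → (∀ g, ∀ u ∈ U, α g u ∈ U) → U = ⊥ ∨ U = ⊤)
    {R' : OrthRep Γ} {α' : Δ →* (R'.V ≃ₗᵢ[ℝ] R'.V)} (hα' : IsCovariant c R' α')
    (hirr' : ∀ U, R'.IsInvariant U → (∀ g, ∀ u ∈ U, α' g u ∈ U) → U = ⊥ ∨ U = ⊤)
    {S : OrthRep Γ} (hS : S.IsIrreducible) (hSR : mult S R ≠ 0) (hSR' : mult S R' ≠ 0)
    {T : OrthRep Γ} (hT : T.IsIrreducible) :
    mult S R' * mult T R = mult S R * mult T R' := by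
  have key : (∃ g, ∃ u : S.V ≃ₗ[ℝ] T.V, ∀ h v, u (S.ρ h v) = T.ρ (c g h) (u v)) →
      mult S R' * mult T R = mult S R * mult T R' := by
    rintro ⟨g, u, hu⟩
    rw [mult_eq_of_twist hα g (hc g) u hu, mult_eq_of_twist hα' g (hc g) u hu, mul_comm]
  by_cases h1 : mult T R = 0
  · by_cases h2 : mult T R' = 0
    · rw [h1, h2, mul_zero, mul_zero]
    · exact key (exists_twist hc hα' hirr' hS hT hSR' h2)
  · exact key (exists_twist hc hα hirr hS hT hSR h1)

end Covariant

end OrthRep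

/-! ### Finite-dimensional subrepresentations of unitary representations of compact groups -/

section PeterWeyl

open MeasureTheory

variable {G : Type*} [Group G] [TopologicalSpace G] [IsTopologicalGroup G] [CompactSpace G]

/-- The normalized Haar measure of a compact group. -/
noncomputable def probHaar (G : Type*) [Group G] [TopologicalSpace G] [IsTopologicalGroup G]
    [CompactSpace G] [MeasurableSpace G] [BorelSpace G] : Measure G :=
  Measure.haarMeasure ⊤

section

variable [MeasurableSpace G] [BorelSpace G]

instance : (probHaar G).IsHaarMeasure := inferInstanceAs (Measure.haarMeasure ⊤).IsHaarMeasure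

instance : (probHaar G).Regular := inferInstanceAs (Measure.haarMeasure ⊤).Regular

instance : IsProbabilityMeasure (probHaar G) :=
  ⟨Measure.haarMeasure_self (G := G) (K₀ := ⊤)⟩

theorem integrable_probHaar_of_continuous {E : Type*} [NormedAddCommGroup E] {f : G → E}
    (hf : Continuous f) : Integrable f (probHaar G) :=
  hf.integrable_of_hasCompactSupport (HasCompactSupport.of_compactSpace f)

end

variable {E : Type*} [NormedAddCommGroup E] [InnerProductSpace ℝ E] [CompleteSpace E]
  (π : G →* (E ≃ₗᵢ[ℝ] E))

/-- The average of the conjugates of a rank one projection is a compact symmetric operator that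
commutes with the action. -/
theorem exists_compact_intertwiner (hπ : ∀ v, Continuous fun g => π g v) {v : E} (hv : v ≠ 0) :
    ∃ T : E →L[ℝ] E, IsCompactOperator T ∧ T.IsSymmetric ∧ T ≠ 0 ∧
      (∀ g x, T (π g x) = π g (T x)) ∧
      ∀ U : Submodule ℝ E, IsClosed (U : Set E) → (∀ g, π g v ∈ U) → ∀ x, T x ∈ U := by
  let _ : MeasurableSpace G := borel G
  have _ : BorelSpace G := ⟨rfl⟩
  let μ := probHaar G
  let F : G → E →L[ℝ] E := fun g => (innerSL ℝ (π g v)).smulRight (π g v)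
  have hFx : ∀ g x, F g x = inner ℝ (π g v) x • π g v := fun g x => rfl
  have hF : Continuous F := by
    have h1 : Continuous fun g => innerSL ℝ (π g v) := (innerSL ℝ).continuous.comp (hπ v)
    exact (ContinuousLinearMap.smulRightL ℝ E E).continuous₂.comp (h1.prodMk (hπ v))
  have hFi : Integrable F μ := integrable_probHaar_of_continuous hF
  have hTx : ∀ x, (∫ g, F g ∂μ) x = ∫ g, F g x ∂μ := fun x =>
    ContinuousLinearMap.integral_apply hFi x
  have hFxi : ∀ x, Integrable (fun g => F g x) μ := fun x =>
    integrable_probHaar_of_continuous (hF.clm_apply continuous_const)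
  have hinner : ∀ x y, inner ℝ ((∫ g, F g ∂μ) x) y = ∫ g, inner ℝ (π g v) x * inner ℝ (π g v) y ∂μ :=
    fun x y => by
      rw [hTx, real_inner_comm, ← integral_inner (hFxi x)]
      refine integral_congr_ae (.of_forall fun g => ?_)
      simp only [hFx, inner_smul_right]
      rw [real_inner_comm y]
  have hcomp : IsCompactOperator ⇑(∫ g, F g ∂μ) := by
    refine Convex.integral_mem (s := {f : E →L[ℝ] E | IsCompactOperator f}) ?_
      isClosed_setOfPred_isCompactOperator (.of_forall fun g => ?_) hFi
    · intro f hf f' hf' a b _ _ _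
      exact (hf.smul a).add (hf'.smul b)
    · have h : IsCompactOperator ⇑(ContinuousLinearMap.toSpanSingleton ℝ (π g v)) :=
        isCompactOperator_of_locallyCompactSpace_rng _
      exact h.comp_clm (innerSL ℝ (π g v))
  refine ⟨∫ g, F g ∂μ, hcomp, fun x y => ?_, fun h0 => ?_, fun h x => ?_, fun U hU hvU x => ?_⟩
  · change inner ℝ ((∫ g, F g ∂μ) x) y = inner ℝ x ((∫ g, F g ∂μ) y)
    rw [hinner, real_inner_comm, hinner]
    simp only [mul_comm]
  · have h1 := hinner v v
    rw [h0, zero_apply, inner_zero_left] at h1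
    have hc : Continuous fun g => inner ℝ (π g v) v * inner ℝ (π g v) v := by
      have : Continuous fun g => inner ℝ (π g v) v := (hπ v).inner continuous_const
      exact this.mul this
    refine (hc.integral_pos_of_hasCompactSupport_nonneg_nonzero (μ := μ)
      (HasCompactSupport.of_compactSpace _) (fun g => mul_self_nonneg _) (x := 1) ?_).ne h1
    rw [map_one]
    simpa using hv
  · rw [hTx, hTx, ← integral_mul_left_eq_self _ h]
    change _ = (π h).toContinuousLinearEquiv.toContinuousLinearMap _
    rw [← ContinuousLinearMap.integral_comp_comm _ (hFxi x)]
    refine integral_congr_ae (.of_forall fun g => ?_)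
    change F (h * g) (π h x) = π h (F g x)
    rw [hFx, hFx, map_mul, map_smul]
    change inner ℝ (π h (π g v)) (π h x) • π h (π g v) = _
    rw [LinearIsometryEquiv.inner_map_map]
  · rw [hTx]
    exact Convex.integral_mem U.convex hU
      (.of_forall fun g => U.smul_mem _ (hvU g)) (hFxi x)

/-- Operators that do not vanish on a unitary representation of a compact group do not vanish on
some finite-dimensional invariant subspace. -/
theorem exists_finiteDimensional_invariant (hπ : ∀ v, Continuous fun g => π g v)
    {Y : Type*} [NormedAddCommGroup Y] [NormedSpace ℝ Y] (J : E →L[ℝ] Y) (hJ : J ≠ 0) :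
    ∃ V : Submodule ℝ E, FiniteDimensional ℝ V ∧ (∀ g, ∀ v ∈ V, π g v ∈ V) ∧ ∃ v ∈ V, J v ≠ 0 := by
  by_contra! hcon
  let S : Submodule ℝ E :=
    sSup {V : Submodule ℝ E | FiniteDimensional ℝ V ∧ ∀ g, ∀ v ∈ V, π g v ∈ V}
  have hSinv : ∀ g, ∀ v ∈ S, π g v ∈ S := by
    intro g v hv
    have hle : S ≤ S.comap (π g).toLinearEquiv.toLinearMap :=
      sSup_le fun V hV x hx => (le_sSup hV : V ≤ S) (hV.2 g x hx)
    exact hle hv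
  have hSJ : S ≤ LinearMap.ker J.toLinearMap :=
    sSup_le fun V hV x hx => hcon V hV.1 hV.2 x hx
  by_cases hbot : Sᗮ = ⊥
  · apply hJ
    have h1 : S.topologicalClosure ≤ LinearMap.ker J.toLinearMap :=
      S.topologicalClosure_minimal hSJ J.isClosed_ker
    rw [Submodule.topologicalClosure_eq_top_iff.2 hbot] at h1
    ext x
    exact h1 (Submodule.mem_top (x := x))
  obtain ⟨v, hvS, hv⟩ := Submodule.exists_mem_ne_zero_of_ne_bot hbot
  obtain ⟨T, hTc, hTs, hT0, hTcomm, hTU⟩ := exists_compact_intertwiner π hπ hv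
  have hTS : ∀ x, T x ∈ Sᗮ := hTU _ (Submodule.isClosed_orthogonal S) fun g u hu => by
    have h1 := hvS _ (hSinv g⁻¹ u hu)
    rw [← (π g).inner_map_map] at h1
    change inner ℝ ((π g * π g⁻¹) u) _ = 0 at h1
    rwa [← map_mul, mul_inv_cancel, map_one] at h1
  obtain ⟨c, hc, hc0⟩ : ∃ c, Module.End.HasEigenvalue (T : Module.End ℝ E) c ∧ c ≠ 0 := by
    by_contra! h
    exact hT0 ((ContinuousLinearMap.eq_zero_of_forall_hasEigenvalue_eq_zero hTc hTs).1 h)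
  obtain ⟨w, hw, hw0⟩ := hc.exists_hasEigenvector
  have hwS : w ∈ S := by
    refine (le_sSup ⟨ContinuousLinearMap.finite_dimensional_eigenspace hTc c hc0, fun g x hx => ?_⟩ :
      Module.End.eigenspace (T : Module.End ℝ E) c ≤ S) hw
    rw [Module.End.mem_eigenspace_iff] at hx ⊢
    change T x = _ at hx
    change T _ = _
    rw [hTcomm, hx, map_smul]
  have hwS' : w ∈ Sᗮ := by
    rw [Module.End.mem_eigenspace_iff] at hw
    have : w = c⁻¹ • T w := by
      change T w = _ at hw
      rw [hw, inv_smul_smul₀ hc0]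
    rw [this]
    exact Submodule.smul_mem _ _ (hTS w)
  exact hw0 (inner_self_eq_zero.1 (hwS' w hwS))

theorem exists_orthRep_of_ne_zero (hπ : ∀ v, Continuous fun g => π g v)
    {Y : Type*} [NormedAddCommGroup Y] [NormedSpace ℝ Y] (J : E →L[ℝ] Y) (hJ : J ≠ 0) :
    ∃ R : OrthRep G, R.IsContinuous ∧ ∃ u : R.V →ₗᵢ[ℝ] E,
      (∀ g v, u (R.ρ g v) = π g (u v)) ∧ ∃ v, J (u v) ≠ 0 := by
  obtain ⟨V, hV, hinv, v, hvV, hv⟩ := exists_finiteDimensional_invariant π hπ J hJ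
  let e : V ≃ₗᵢ[ℝ] EuclideanSpace ℝ (Fin (Module.finrank ℝ V)) := (stdOrthonormalBasis ℝ V).repr
  let r : G → V → V := fun g x => ⟨π g x, hinv g x x.2⟩
  have r_mul : ∀ g h x, r (g * h) x = r g (r h x) := fun g h x =>
    Subtype.ext (by simp only [r, map_mul]; rfl)
  have r_one : ∀ x, r 1 x = x := fun x => Subtype.ext (by simp only [r, map_one]; rfl)
  let ρ : G → (V ≃ₗᵢ[ℝ] V) := fun g =>
    { toFun := r g
      invFun := r g⁻¹
      map_add' := fun u v => Subtype.ext (map_add (π g) (u : E) v)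
      map_smul' := fun c u => Subtype.ext (map_smul (π g) c (u : E))
      left_inv := fun u => by rw [← r_mul, inv_mul_cancel, r_one]
      right_inv := fun u => by rw [← r_mul, mul_inv_cancel, r_one]
      norm_map' := fun u => (π g).norm_map u }
  let R : OrthRep G :=
    { V := EuclideanSpace ℝ (Fin (Module.finrank ℝ V))
      ρ :=
        { toFun := fun g => (e.symm.trans (ρ g)).trans e
          map_one' := by
            ext1 x
            change e (r 1 (e.symm x)) = x
            rw [r_one, e.apply_symm_apply]
          map_mul' := fun g h => by
            ext1 x
            change e (r (g * h) (e.symm x)) = e (r g (e.symm (e (r h (e.symm x)))))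
            rw [r_mul, e.symm_apply_apply] } }
  refine ⟨R, fun x => ?_, V.subtypeₗᵢ.comp e.symm.toLinearIsometry, fun g x => ?_, e ⟨v, hvV⟩, ?_⟩
  · exact e.continuous.comp ((hπ _).subtype_mk _)
  · change ((e.symm (e (r g (e.symm x))) : V) : E) = _
    rw [e.symm_apply_apply]
    rfl
  · change J ((e.symm (e ⟨v, hvV⟩) : V) : E) ≠ 0
    rwa [e.symm_apply_apply]

end PeterWeyl

/-! ### The regular representation -/

section Regular

open MeasureTheory

variable {G : Type*} [Group G] [TopologicalSpace G] [IsTopologicalGroup G] [CompactSpace G]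
  [MeasurableSpace G] [BorelSpace G]

/-- The left regular representation of a compact group. -/
noncomputable def leftRegular (G : Type*) [Group G] [TopologicalSpace G] [IsTopologicalGroup G]
    [CompactSpace G] [MeasurableSpace G] [BorelSpace G] :
    G →* (Lp ℝ 2 (probHaar G) ≃ₗᵢ[ℝ] Lp ℝ 2 (probHaar G)) where
  toFun g :=
    { toFun := fun f => DomMulAct.mk g⁻¹ • f
      invFun := fun f => DomMulAct.mk g • f
      map_add' := fun f f' => smul_add _ f f'
      map_smul' := fun c f => smul_comm _ c f
      left_inv := fun f => by
        beta_reduce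
        rw [← mul_smul, ← DomMulAct.mk_mul, inv_mul_cancel, DomMulAct.mk_one, one_smul]
      right_inv := fun f => by
        beta_reduce
        rw [← mul_smul, ← DomMulAct.mk_mul, mul_inv_cancel, DomMulAct.mk_one, one_smul]
      norm_map' := fun f => DomMulAct.norm_smul_Lp _ f }
  map_one' := by
    ext1 f
    change DomMulAct.mk (1 : G)⁻¹ • f = f
    rw [inv_one, DomMulAct.mk_one, one_smul]
  map_mul' g h := by
    ext1 f
    change DomMulAct.mk (g * h)⁻¹ • f = DomMulAct.mk g⁻¹ • DomMulAct.mk h⁻¹ • f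
    rw [← mul_smul, ← DomMulAct.mk_mul, mul_inv_rev]

theorem continuous_leftRegular (f : Lp ℝ 2 (probHaar G)) :
    Continuous fun g => leftRegular G g f := by
  have h : Continuous fun g : G => DomMulAct.mk g⁻¹ :=
    DomMulAct.mkHomeomorph.continuous.comp continuous_inv
  have : Fact ((2 : ENNReal) ≠ ⊤) := ⟨by simp⟩
  exact h.smul continuous_const

/-- The class of a continuous function in `L²`. -/
noncomputable def contToL2 (f : C(G, ℝ)) : Lp ℝ 2 (probHaar G) :=
  (f.continuous.memLp_of_hasCompactSupport (HasCompactSupport.of_compactSpace f)).toLp f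

theorem leftRegular_contToL2 (g : G) (f : C(G, ℝ)) :
    leftRegular G g (contToL2 f) = contToL2 (f.comp ⟨fun x => g⁻¹ * x, by fun_prop⟩) :=
  DomMulAct.mk_smul_toLp (g⁻¹) _

theorem contToL2_injective : Injective (contToL2 (G := G)) := fun f f' h => by
  have h1 := (MemLp.toLp_eq_toLp_iff _ _).1 h
  exact DFunLike.coe_injective ((Continuous.ae_eq_iff_eq (probHaar G) f.continuous f'.continuous).1 h1)

end Regular

section Separation

open MeasureTheory

variable {G : Type*} [Group G] [TopologicalSpace G] [IsTopologicalGroup G] [CompactSpace G]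

/-- Finite-dimensional representations of a compact group separate points. -/
theorem exists_orthRep_apply_ne [T2Space G] {x : G} (hx : x ≠ 1) :
    ∃ R : OrthRep G, R.IsContinuous ∧ ∃ v, R.ρ x v ≠ v := by
  let _ : MeasurableSpace G := borel G
  have _ : BorelSpace G := ⟨rfl⟩
  let J : Lp ℝ 2 (probHaar G) →L[ℝ] Lp ℝ 2 (probHaar G) :=
    (leftRegular G x).toContinuousLinearEquiv.toContinuousLinearMap - ContinuousLinearMap.id ℝ _
  have hJ : J ≠ 0 := by
    intro h0
    obtain ⟨f, hf0, hf1, -⟩ := exists_continuous_zero_one_of_isClosed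
      (isClosed_singleton (x := x⁻¹)) (isClosed_singleton (x := (1 : G)))
      (Set.disjoint_singleton.2 (inv_ne_one.2 hx))
    have h1 : leftRegular G x (contToL2 f) - contToL2 f = 0 :=
      congrArg (fun J : Lp ℝ 2 (probHaar G) →L[ℝ] Lp ℝ 2 (probHaar G) => J (contToL2 f)) h0
    rw [leftRegular_contToL2, sub_eq_zero] at h1
    have h2 := congrArg (fun f : C(G, ℝ) => f 1) (contToL2_injective h1)
    simp [hf0 rfl, hf1 rfl] at h2
  obtain ⟨R, hR, u, hu, v, hv⟩ :=
    exists_orthRep_of_ne_zero (leftRegular G) continuous_leftRegular J hJ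
  refine ⟨R, hR, v, fun h => hv ?_⟩
  change leftRegular G x (u v) - u v = 0
  rw [← hu, h, sub_self]

theorem contToL2_add [MeasurableSpace G] [BorelSpace G] (f f' : C(G, ℝ)) :
    contToL2 (f + f') = contToL2 f + contToL2 f' := rfl

theorem contToL2_smul [MeasurableSpace G] [BorelSpace G] (c : ℝ) (f : C(G, ℝ)) :
    contToL2 (c • f) = c • contToL2 f := rfl

variable {H : Type*} [Group H] [TopologicalSpace H] [IsTopologicalGroup H] [CompactSpace H]

theorem continuous_integral_continuousMap [MeasurableSpace H] [BorelSpace H] {V : Type*}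
    [NormedAddCommGroup V] [NormedSpace ℝ V] :
    Continuous fun f : C(H, V) => ∫ h, f h ∂(probHaar H) := by
  refine LipschitzWith.continuous (K := 1) (LipschitzWith.of_dist_le_mul fun f f' => ?_)
  rw [NNReal.coe_one, one_mul, dist_eq_norm, ← integral_sub
    (integrable_probHaar_of_continuous f.continuous)
    (integrable_probHaar_of_continuous f'.continuous)]
  refine (norm_integral_le_of_norm_le_const (C := dist f f') (.of_forall fun h => ?_)).trans ?_
  · rw [← dist_eq_norm]
    exact ContinuousMap.dist_apply_le_dist h
  · simp

/-- A nonzero vector-valued function on `G` that is equivariant under a closed subgroup. -/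
theorem exists_equivariant_function [T2Space G] (φ : H →ₜ* G) (hφ : Injective φ)
    (S : OrthRep H) (hS : S.IsContinuous) [Nontrivial S.V] :
    ∃ c : C(G, S.V), c 1 ≠ 0 ∧ ∀ h x, c (φ h * x) = S.ρ h (c x) := by
  let _ : MeasurableSpace H := borel H
  have _ : BorelSpace H := ⟨rfl⟩
  have hemb : IsClosedEmbedding φ := φ.continuous_toFun.isClosedEmbedding hφ
  obtain ⟨s, hs⟩ := exists_ne (0 : S.V)
  obtain ⟨ψ, hψ⟩ := ContinuousMap.exists_extension hemb
    (⟨fun h => inner ℝ (S.ρ h⁻¹ s) s, ((hS s).comp continuous_inv).inner continuous_const⟩ : C(H, ℝ))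
  have hψ' : ∀ h, ψ (φ h) = inner ℝ (S.ρ h⁻¹ s) s := fun h => congrArg (fun f : C(H, ℝ) => f h) hψ
  let K : C(G × H, S.V) := ⟨fun p => ψ ((φ p.2)⁻¹ * p.1) • S.ρ p.2 s, by
    have h1 : Continuous fun p : G × H => (φ p.2)⁻¹ * p.1 :=
      (φ.continuous_toFun.comp continuous_snd).inv.mul continuous_fst
    exact (ψ.continuous.comp h1).smul ((hS s).comp continuous_snd)⟩
  let c : C(G, S.V) := ⟨fun x => ∫ h, K.curry x h ∂(probHaar H),
    continuous_integral_continuousMap.comp K.curry.continuous⟩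
  have hc : ∀ x, c x = ∫ h, ψ ((φ h)⁻¹ * x) • S.ρ h s ∂(probHaar H) := fun x => rfl
  have hint : ∀ x, Integrable (fun h => ψ ((φ h)⁻¹ * x) • S.ρ h s) (probHaar H) := fun x =>
    integrable_probHaar_of_continuous (K.curry x).continuous
  refine ⟨c, fun h0 => ?_, fun k x => ?_⟩
  · have h1 : inner ℝ s (c 1) = 0 := by rw [h0, inner_zero_right]
    rw [hc, ← integral_inner (hint 1)] at h1
    have h2 : ∀ h, inner ℝ s (ψ ((φ h)⁻¹ * 1) • S.ρ h s) =
        inner ℝ (S.ρ h s) s * inner ℝ (S.ρ h s) s := fun h => by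
      rw [mul_one, ← map_inv, hψ', inv_inv, inner_smul_right, real_inner_comm s]
    simp only [h2] at h1
    have hcont : Continuous fun h => inner ℝ (S.ρ h s) s * inner ℝ (S.ρ h s) s := by
      have : Continuous fun h => inner ℝ (S.ρ h s) s := (hS s).inner continuous_const
      exact this.mul this
    refine (hcont.integral_pos_of_hasCompactSupport_nonneg_nonzero (μ := probHaar H)
      (HasCompactSupport.of_compactSpace _) (fun g => mul_self_nonneg _) (x := 1) ?_).ne' h1
    rw [OrthRep.ρ_one_apply]
    simpa using hs
  · rw [hc, hc, ← integral_mul_left_eq_self _ k]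
    change _ = (S.ρ k).toContinuousLinearEquiv.toContinuousLinearMap _
    rw [← ContinuousLinearMap.integral_comp_comm _ (hint x)]
    refine integral_congr_ae (.of_forall fun h => ?_)
    change ψ ((φ (k * h))⁻¹ * (φ k * x)) • S.ρ (k * h) s = S.ρ k (ψ ((φ h)⁻¹ * x) • S.ρ h s)
    rw [map_smul, OrthRep.ρ_mul_apply, map_mul φ]
    congr 2
    group

/-- Every representation of a closed subgroup occurs in the restriction of a representation of the
whole group. -/
theorem exists_mult_comap_ne_zero [T2Space G] (φ : H →ₜ* G) (hφ : Injective φ)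
    (S : OrthRep H) (hS : S.IsContinuous) [Nontrivial S.V] :
    ∃ R : OrthRep G, R.IsContinuous ∧ OrthRep.mult S (R.comap (φ : H →* G)) ≠ 0 := by
  let _ : MeasurableSpace G := borel G
  have _ : BorelSpace G := ⟨rfl⟩
  obtain ⟨c, hc1, hc⟩ := exists_equivariant_function φ hφ S hS
  let κ : S.V → C(G, ℝ) := fun s => ⟨fun x => inner ℝ (c x) s, c.continuous.inner continuous_const⟩
  let K : S.V →ₗ[ℝ] Lp ℝ 2 (probHaar G) :=
    { toFun := fun s => contToL2 (κ s)
      map_add' := fun s t => by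
        rw [← contToL2_add]
        exact congrArg _ (ContinuousMap.ext fun x => inner_add_right _ _ _)
      map_smul' := fun r s => by
        rw [RingHom.id_apply, ← contToL2_smul]
        exact congrArg _ (ContinuousMap.ext fun x => inner_smul_right _ _ _) }
  have hK : ∀ h s, K (S.ρ h s) = leftRegular G (φ h) (K s) := fun h s => by
    change contToL2 _ = leftRegular G (φ h) (contToL2 _)
    rw [leftRegular_contToL2]
    refine congrArg _ (ContinuousMap.ext fun x => ?_)
    change inner ℝ (c x) (S.ρ h s) = inner ℝ (c ((φ h)⁻¹ * x)) s
    rw [← map_inv, hc, OrthRep.inner_ρ_left, inv_inv]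
  let J : Lp ℝ 2 (probHaar G) →L[ℝ] S.V := ContinuousLinearMap.adjoint (LinearMap.toContinuousLinearMap K)
  have hJinner : ∀ f s, inner ℝ (J f) s = inner ℝ f (K s) := fun f s =>
    ContinuousLinearMap.adjoint_inner_left _ s f
  have hJequiv : ∀ h f, J (leftRegular G (φ h) f) = S.ρ h (J f) := fun h f => by
    refine ext_inner_right ℝ fun s => ?_
    rw [hJinner, OrthRep.inner_ρ_left, hJinner, hK, map_inv, map_inv]
    change _ = inner ℝ f ((leftRegular G (φ h)).symm (K s))
    rw [← (leftRegular G (φ h)).inner_map_map f, LinearIsometryEquiv.apply_symm_apply]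
  have hJ0 : J ≠ 0 := by
    intro h0
    have h1 : K (c 1) = 0 := by
      rw [← inner_self_eq_zero (𝕜 := ℝ), ← hJinner, h0, zero_apply, inner_zero_left]
    have h2 : κ (c 1) = 0 := contToL2_injective h1
    have h3 : inner ℝ (c 1) (c 1) = 0 := congrArg (fun f : C(G, ℝ) => f 1) h2
    exact hc1 (inner_self_eq_zero.1 h3)
  obtain ⟨R, hR, u, hu, v, hv⟩ :=
    exists_orthRep_of_ne_zero (leftRegular G) continuous_leftRegular J hJ0
  refine ⟨R, hR, OrthRep.mult_ne_zero_comm (OrthRep.mult_ne_zero_iff.2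
    ⟨J.toLinearMap ∘ₗ u.toLinearMap, fun h w => ?_, fun h0 => hv (congrArg (fun f => f v) h0)⟩)⟩
  exact (congrArg J (hu (φ h) w)).trans (hJequiv h (u w))

end Separation

namespace OrthRep

variable {Γ : Type*} [Group Γ] {Δ : Type*} [Group Δ]

/-- The zero representation. -/
noncomputable def zero (Γ : Type*) [Group Γ] : OrthRep Γ := ⟨EuclideanSpace ℝ (Fin 0), 1⟩

/-- The direct sum of `n` copies of a representation. -/
noncomputable def npow (R : OrthRep Γ) : ℕ → OrthRep Γ
  | 0 => zero Γ
  | n + 1 => (npow R n).prod R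

theorem comap_prod (f : Δ →* Γ) (R R' : OrthRep Γ) :
    (R.prod R').comap f = (R.comap f).prod (R'.comap f) := rfl

theorem comap_npow (f : Δ →* Γ) (R : OrthRep Γ) (n : ℕ) :
    (R.npow n).comap f = (R.comap f).npow n := by
  induction n with
  | zero => rfl
  | succ n ih => rw [npow, npow, comap_prod, ih]

theorem mult_zero (S : OrthRep Γ) : mult S (zero Γ) = 0 :=
  have : Subsingleton (zero Γ).V := inferInstanceAs (Subsingleton (EuclideanSpace ℝ (Fin 0)))
  mult_eq_zero_of_subsingleton _ _

theorem mult_npow (S R : OrthRep Γ) (n : ℕ) : mult S (R.npow n) = n * mult S R := by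
  induction n with
  | zero => rw [npow, mult_zero, zero_mul]
  | succ n ih => rw [npow, mult_prod, ih, add_one_mul]

theorem exists_npow_apply_ne {R : OrthRep Γ} {g : Γ} (h : ∃ v, R.ρ g v ≠ v) {n : ℕ} (hn : n ≠ 0) :
    ∃ v, (R.npow n).ρ g v ≠ v := by
  obtain ⟨v, hv⟩ := h
  obtain ⟨n, rfl⟩ := Nat.exists_eq_succ_of_ne_zero hn
  exact ⟨WithLp.toLp 2 (0, v), fun h => hv (congrArg WithLp.snd h)⟩

theorem Equivalent.comap {R R' : OrthRep Γ} (f : Δ →* Γ) :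
    R.Equivalent R' → (R.comap f).Equivalent (R'.comap f) := by
  rintro ⟨u, hu⟩
  exact ⟨u, fun g v => hu (f g) v⟩

section Continuous

variable [TopologicalSpace Γ]

theorem IsContinuous.prod {R R' : OrthRep Γ} (hR : R.IsContinuous) (hR' : R'.IsContinuous) :
    (R.prod R').IsContinuous := fun v =>
  (WithLp.prod_continuous_toLp 2 R.V R'.V).comp ((hR v.fst).prodMk (hR' v.snd))

theorem isContinuous_zero : (zero Γ).IsContinuous := fun _ => continuous_const

theorem IsContinuous.npow {R : OrthRep Γ} (hR : R.IsContinuous) (n : ℕ) :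
    (R.npow n).IsContinuous := by
  induction n with
  | zero => exact isContinuous_zero
  | succ n ih => exact ih.prod hR

theorem IsContinuous.sub {R : OrthRep Γ} (hR : R.IsContinuous) {U : Submodule ℝ R.V}
    (hU : R.IsInvariant U) : (R.sub U hU).IsContinuous := fun v =>
  (hR (U.subtype v)).subtype_mk _

theorem IsContinuous.comap [TopologicalSpace Δ] {R : OrthRep Γ} (hR : R.IsContinuous)
    {f : Δ →* Γ} (hf : Continuous f) : (R.comap f).IsContinuous := fun v => (hR v).comp hf

end Continuous

/-! ### Extending multiples of covariant representations -/

theorem isCovariant_sub {c : Δ → Γ → Γ} {R : OrthRep Γ} {α : Δ →* (R.V ≃ₗᵢ[ℝ] R.V)}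
    (hα : IsCovariant c R α) {U : Submodule ℝ R.V} (hU : R.IsInvariant U)
    (hUα : (OrthRep.mk R.V α).IsInvariant U) :
    IsCovariant c (R.sub U hU) ((OrthRep.mk R.V α).sub U hUα).ρ :=
  fun g h v => Subtype.ext (hα g h (U.subtype v))

theorem isIrreducible_pair_sub {R : OrthRep Γ} {α : Δ →* (R.V ≃ₗᵢ[ℝ] R.V)} {U : Submodule ℝ R.V}
    (hU : R.IsInvariant U) (hUα : (OrthRep.mk R.V α).IsInvariant U)
    (h : ∀ U' ≤ U, R.IsInvariant U' → (OrthRep.mk R.V α).IsInvariant U' → U' ≠ ⊥ → U' = U)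
    (W : Submodule ℝ U) (hW : (R.sub U hU).IsInvariant W)
    (hWα : ((OrthRep.mk R.V α).sub U hUα).IsInvariant W) : W = ⊥ ∨ W = ⊤ := by
  by_cases hW0 : W = ⊥
  · exact Or.inl hW0
  right
  have hmap : W.map U.subtype = U := by
    refine h _ (Submodule.map_subtype_le U W) ?_ ?_ ?_
    · rintro g _ ⟨w, hw, rfl⟩
      exact ⟨_, hW g w hw, rfl⟩
    · rintro g _ ⟨w, hw, rfl⟩
      exact ⟨_, hWα g w hw, rfl⟩
    · exact fun h => hW0 (Submodule.map_injective_of_injective U.subtype_injective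
        (h.trans (Submodule.map_bot _).symm))
  apply Submodule.map_injective_of_injective U.subtype_injective
  rw [hmap, Submodule.map_subtype_top]

/-- If `S` occurs in the restriction of a representation then it occurs in the restriction of an
irreducible representation. -/
theorem exists_isIrreducible_mult_comap_ne_zero [TopologicalSpace Γ] (f : Δ →* Γ) {S : OrthRep Δ}
    {R : OrthRep Γ} (hR : R.IsContinuous) (h : mult S (R.comap f) ≠ 0) :
    ∃ W : OrthRep Γ, W.IsContinuous ∧ mult S (W.comap f) ≠ 0 ∧
      ∀ U, W.IsInvariant U → U = ⊥ ∨ U = ⊤ := by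
  induction hn : Module.finrank ℝ R.V using Nat.strong_induction_on generalizing R with
  | _ n ih =>
  by_cases hirr : ∀ U, R.IsInvariant U → U = ⊥ ∨ U = ⊤
  · exact ⟨R, hR, h, hirr⟩
  push Not at hirr
  obtain ⟨U, hU, hU0, hU1⟩ := hirr
  rw [mult_eq_of_equivalent S ((R.equivalent_prod_orthogonal U hU).comap f), comap_prod,
    mult_prod] at h
  have hsum := U.finrank_add_finrank_orthogonal
  have h1 : Module.finrank ℝ U ≠ 0 := by rwa [Ne, Submodule.finrank_eq_zero]
  have h2 : Module.finrank ℝ Uᗮ ≠ 0 := by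
    rwa [Ne, Submodule.finrank_eq_zero, Submodule.orthogonal_eq_bot_iff]
  by_cases h3 : mult S ((R.sub U hU).comap f) = 0
  · refine ih (Module.finrank ℝ Uᗮ) (by omega) (hR.sub hU.orthogonal) ?_ rfl
    omega
  · exact ih (Module.finrank ℝ U) (by omega) (hR.sub hU) h3 rfl

theorem exists_comap_mult_eq_mul {G H : Type*} [Group G] [TopologicalSpace G]
    [IsTopologicalGroup G] [CompactSpace G] [T2Space G] [Group H] [TopologicalSpace H]
    [IsTopologicalGroup H] [CompactSpace H] (φ : H →ₜ* G) (hφ : Injective φ)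
    {c : G → H → H} (hc : ∀ g h, φ (c g h) = g * φ h * g⁻¹) (hcs : ∀ g, Surjective (c g))
    (R : OrthRep H) (hR : R.IsContinuous) (α : G →* (R.V ≃ₗᵢ[ℝ] R.V)) (hα : IsCovariant c R α) :
    ∃ N : ℕ, N ≠ 0 ∧ ∃ W : OrthRep G, W.IsContinuous ∧ ∀ T : OrthRep H, T.IsIrreducible →
      mult T (W.comap (φ : H →* G)) = N * mult T R := by
  induction hn : Module.finrank ℝ R.V using Nat.strong_induction_on generalizing R with
  | _ n ih =>
  by_cases hR0 : Subsingleton R.V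
  · refine ⟨1, one_ne_zero, zero G, isContinuous_zero, fun T _ => ?_⟩
    rw [mult_eq_zero_of_subsingleton T R]
    exact mult_zero T
  rw [not_subsingleton_iff_nontrivial] at hR0
  obtain ⟨U, -, ⟨hU, hUα, hU0⟩, hUmin⟩ := exists_minimal_le_of_wellFoundedLT
    (fun U : Submodule ℝ R.V => R.IsInvariant U ∧ (OrthRep.mk R.V α).IsInvariant U ∧ U ≠ ⊥) ⊤
    ⟨fun _ _ _ => Submodule.mem_top, fun _ _ _ => Submodule.mem_top, top_ne_bot⟩
  have hUirr := isIrreducible_pair_sub hU hUα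
    fun U' hle h1 h2 h3 => le_antisymm hle (hUmin ⟨h1, h2, h3⟩ hle)
  obtain ⟨S₀, hS₀, hSU, hS0, hSirr⟩ := R.exists_isIrreducible_sub hU hU0
  set S := R.sub S₀ hS₀
  have hSRU : mult S (R.sub U hU) ≠ 0 := by
    refine mult_ne_zero_iff.2 ⟨Submodule.inclusion hSU, fun _ _ => rfl, fun h => hS0 ?_⟩
    rw [Submodule.eq_bot_iff]
    intro x hx
    exact congrArg (fun f => U.subtype (f ⟨x, hx⟩)) h
  have := hSirr.1
  obtain ⟨W₀, hW₀, hSW₀⟩ := exists_mult_comap_ne_zero φ hφ S (hR.sub hS₀)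
  obtain ⟨W, hW, hSW, hWirr⟩ := exists_isIrreducible_mult_comap_ne_zero (φ : H →* G) hW₀ hSW₀
  have hWcov : IsCovariant c (W.comap (φ : H →* G)) W.ρ := fun g h v => by
    have key : ∀ w : W.V, W.ρ g (W.ρ (φ h) w) = W.ρ (φ (c g h)) (W.ρ g w) := fun w => by
      rw [← ρ_mul_apply, ← ρ_mul_apply, hc, inv_mul_cancel_right]
    exact key v
  have hprop := fun T hT => mult_mul_mult_eq hcs (isCovariant_sub hα hU hUα) hUirr hWcov
    (fun U _ hU => hWirr U hU) hSirr hSRU hSW (T := T) hT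
  have hlt : Module.finrank ℝ Uᗮ < n := by
    have h1 := U.finrank_add_finrank_orthogonal
    have h2 : Module.finrank ℝ U ≠ 0 := by rwa [Ne, Submodule.finrank_eq_zero]
    omega
  obtain ⟨N, hN, W', hW', hW'N⟩ := ih _ hlt (R.sub Uᗮ hU.orthogonal) (hR.sub hU.orthogonal)
    _ (isCovariant_sub hα hU.orthogonal hUα.orthogonal) rfl
  set m := mult S (W.comap (φ : H →* G))
  set k := mult S (R.sub U hU)
  refine ⟨N * m, mul_ne_zero hN hSW, (W.npow (N * k)).prod (W'.npow m),
    (hW.npow _).prod (hW'.npow _), fun T hT => ?_⟩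
  rw [comap_prod, mult_prod, comap_npow, comap_npow, mult_npow, mult_npow, hW'N T hT,
    mult_eq_of_equivalent T (R.equivalent_prod_orthogonal U hU), mult_prod, mul_assoc N k,
    ← hprop T hT]
  ring

end OrthRep

/-! ### Covariant representations from semidirect products -/

section Semidirect

variable {H : Type*} [Group H] [TopologicalSpace H] [IsTopologicalGroup H] [CompactSpace H]
  [T2Space H] {K : Type*} [Group K] [TopologicalSpace K] [IsTopologicalGroup K] [CompactSpace K]
  [T2Space K]

theorem exists_covariant_orthRep (act : K →* MulAut H)
    (hact : Continuous fun p : K × H => act p.1 p.2)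
    {h : H} (hh : h ≠ 1) :
    ∃ R : OrthRep H, R.IsContinuous ∧ (∃ v, R.ρ h v ≠ v) ∧ ∃ α : K →* (R.V ≃ₗᵢ[ℝ] R.V),
      ∀ k h v, α k (R.ρ h v) = R.ρ (act k h) (α k v) := by
  let _ : TopologicalSpace (H ⋊[act] K) := .induced SemidirectProduct.equivProd inferInstance
  let e : H ⋊[act] K ≃ₜ H × K := SemidirectProduct.equivProd.toHomeomorphOfIsInducing ⟨rfl⟩
  have hl : Continuous fun x : H ⋊[act] K => x.left := continuous_fst.comp e.continuous
  have hr : Continuous fun x : H ⋊[act] K => x.right := continuous_snd.comp e.continuous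
  have _ : CompactSpace (H ⋊[act] K) := e.symm.compactSpace
  have _ : T2Space (H ⋊[act] K) := e.symm.t2Space
  have _ : IsTopologicalGroup (H ⋊[act] K) :=
    { continuous_mul := by
        refine e.isInducing.continuous_iff.2 (.prodMk ?_ ?_)
        · exact (hl.comp continuous_fst).mul
            (hact.comp ((hr.comp continuous_fst).prodMk (hl.comp continuous_snd)))
        · exact (hr.comp continuous_fst).mul (hr.comp continuous_snd)
      continuous_inv := by
        refine e.isInducing.continuous_iff.2 (.prodMk ?_ hr.inv)
        exact hact.comp (hr.inv.prodMk hl.inv) }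
  obtain ⟨R, hR, hv⟩ := exists_orthRep_apply_ne (x := (SemidirectProduct.inl h : H ⋊[act] K))
    (fun h1 => hh (SemidirectProduct.inl_injective (h1.trans (map_one _).symm)))
  refine ⟨R.comap SemidirectProduct.inl, hR.comap
    (e.isInducing.continuous_iff.2 (continuous_id.prodMk continuous_const)), hv,
    R.ρ.comp SemidirectProduct.inr, fun k h v => ?_⟩
  have key : ∀ w : R.V, R.ρ (SemidirectProduct.inr k) (R.ρ (SemidirectProduct.inl h) w) =
      R.ρ (SemidirectProduct.inl (act k h)) (R.ρ (SemidirectProduct.inr k) w) := fun w => by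
    rw [← OrthRep.ρ_mul_apply, ← OrthRep.ρ_mul_apply, SemidirectProduct.inl_aut,
      map_inv, inv_mul_cancel_right]
  exact key v

end Semidirect

/-! ### Compact subgroups of the automorphism group -/

namespace ContAut

variable {H : Type u} [Group H] [TopologicalSpace H]

/-- The underlying continuous map of an automorphism. -/
def toContinuousMap (a : ContAut H) : C(H, H) := ⟨a, map_continuous a⟩

theorem toContinuousMap_injective : Injective (toContinuousMap : ContAut H → C(H, H)) :=
  fun _ _ h => ext fun y => congrArg (fun f : C(H, H) => f y) h

/-- The action of the automorphism group on the underlying abstract group. -/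
def toMulAut : ContAut H →* MulAut H where
  toFun a := (a : H ≃* H)
  map_one' := rfl
  map_mul' _ _ := rfl

variable [IsTopologicalGroup H] [CompactSpace H]

theorem isInducing_toContinuousMap : IsInducing (toContinuousMap : ContAut H → C(H, H)) :=
  ⟨uniformTopology_eq_compactOpen⟩

theorem continuous_iff {X : Type*} [TopologicalSpace X] {f : X → ContAut H} :
    Continuous f ↔ Continuous fun p : X × H => f p.1 p.2 := by
  refine ⟨fun h => ?_, fun h => ?_⟩
  · have h1 : Continuous fun x => (f x).toContinuousMap :=
      isInducing_toContinuousMap.continuous.comp h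
    exact (h1.comp continuous_fst).eval continuous_snd
  · exact isInducing_toContinuousMap.continuous_iff.2 (ContinuousMap.curry ⟨_, h⟩).continuous

variable [T2Space H]

instance : T2Space (ContAut H) :=
  .of_injective_continuous toContinuousMap_injective isInducing_toContinuousMap.continuous

theorem isTopologicalGroup_of_isCompact {K : Subgroup (ContAut H)}
    (hK : IsCompact (K : Set (ContAut H))) : IsTopologicalGroup K := by
  have hev : Continuous fun p : K × H => (p.1 : ContAut H) p.2 :=
    continuous_iff.1 continuous_subtype_val
  have : CompactSpace K := isCompact_iff_compactSpace.1 hK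
  refine { continuous_mul := ?_, continuous_inv := ?_ }
  · refine Continuous.subtype_mk (continuous_iff.2 ?_) _
    have h1 : Continuous fun p : (K × K) × H => (p.1.2 : ContAut H) p.2 :=
      hev.comp ((continuous_snd.comp continuous_fst).prodMk continuous_snd)
    exact hev.comp ((continuous_fst.comp continuous_fst).prodMk h1)
  · refine Continuous.subtype_mk (continuous_iff.2 ?_) _
    let e : K × H ≃ K × H :=
      { toFun := fun p => (p.1, (p.1 : ContAut H) p.2)
        invFun := fun p => (p.1, (p.1⁻¹ : ContAut H) p.2)
        left_inv := fun p => Prod.ext rfl (by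
          change ((p.1 : ContAut H)⁻¹ * p.1) p.2 = p.2
          rw [inv_mul_cancel, one_apply])
        right_inv := fun p => Prod.ext rfl (by
          change ((p.1 : ContAut H) * (p.1 : ContAut H)⁻¹) p.2 = p.2
          rw [mul_inv_cancel, one_apply]) }
    have he : Continuous e := continuous_fst.prodMk hev
    exact continuous_snd.comp (he.homeoOfEquivCompactToT2).symm.continuous

end ContAut

/-! ### Finite-dimensional representations of pushouts -/

section Pushout

variable {ι : Type w} {H : Type u} {G : ι → Type v}
  [Group H] [TopologicalSpace H]
  [∀ i, Group (G i)] [∀ i, TopologicalSpace (G i)]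
  {φ : ∀ i, H →ₜ* G i}

instance (V : Type*) [NormedAddCommGroup V] [InnerProductSpace ℝ V] [FiniteDimensional ℝ V] :
    CompactSpace (unitary (V →L[ℝ] V)) := by
  have : ProperSpace (V →L[ℝ] V) := FiniteDimensional.proper ℝ _
  refine isCompact_iff_compactSpace.1 (Metric.isCompact_of_isClosed_isBounded isClosed_unitary ?_)
  refine (Metric.isBounded_closedBall (x := (0 : V →L[ℝ] V)) (r := 1)).subset fun u hu => ?_
  rw [mem_closedBall_zero_iff]
  refine ContinuousLinearMap.opNorm_le_bound _ zero_le_one fun x => ?_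
  rw [one_mul, Unitary.norm_map ⟨u, hu⟩ x]

theorem continuous_unitary {X V : Type*} [TopologicalSpace X] [NormedAddCommGroup V]
    [InnerProductSpace ℝ V] [FiniteDimensional ℝ V] {f : X → (V ≃ₗᵢ[ℝ] V)}
    (hf : ∀ v, Continuous fun x => f x v) :
    Continuous fun x => (Unitary.linearIsometryEquiv (𝕜 := ℝ) (H := V)).symm (f x) :=
  Continuous.subtype_mk (continuous_clm_apply.2 hf) _

/-- Elements of the algebraic pushout that act nontrivially in a continuous finite-dimensional
orthogonal representation survive in the compact pushout. -/
theorem ofAlg_ne_one_of_lift_ne_one {V : Type*} [NormedAddCommGroup V] [InnerProductSpace ℝ V]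
    [FiniteDimensional ℝ V] (π : ∀ i, G i →* (V ≃ₗᵢ[ℝ] V)) (κ : H →* (V ≃ₗᵢ[ℝ] V))
    (hπ : ∀ i v, Continuous fun g => π i g v) (hκ : ∀ v, Continuous fun h => κ h v)
    (hφ : ∀ i, (π i).comp (φ i : H →* G i) = κ) {x : AlgPushout φ}
    (hx : Monoid.PushoutI.lift π κ hφ x ≠ 1) : CompactPushout.ofAlg φ x ≠ 1 := by
  intro h1
  let e : (V ≃ₗᵢ[ℝ] V) →* unitary (V →L[ℝ] V) :=
    (Unitary.linearIsometryEquiv (𝕜 := ℝ) (H := V)).symm.toMonoidHom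
  obtain ⟨F, hF, hFk⟩ := CompactPushout.exists_lift (φ := φ)
    (fun i => (⟨e.comp (π i), continuous_unitary (hπ i)⟩ : G i →ₜ* unitary (V →L[ℝ] V)))
    (⟨e.comp κ, continuous_unitary hκ⟩ : H →ₜ* unitary (V →L[ℝ] V))
    (fun i => by
      ext h : 1
      exact congrArg e (DFunLike.congr_fun (hφ i) h))
  have key : (F : CompactPushout φ →* unitary (V →L[ℝ] V)).comp (CompactPushout.ofAlg φ) =
      e.comp (Monoid.PushoutI.lift π κ hφ) := by
    refine Monoid.PushoutI.hom_ext (fun i => ?_) ?_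
    · ext1 g
      change F (CompactPushout.ofAlg φ (Monoid.PushoutI.of i g)) =
        e (Monoid.PushoutI.lift π κ hφ (Monoid.PushoutI.of i g))
      rw [Monoid.PushoutI.lift_of, CompactPushout.ofAlg_eq_diag]
      exact DFunLike.congr_fun (hF i) g
    · ext1 h
      change F (CompactPushout.ofAlg φ (Monoid.PushoutI.base _ h)) =
        e (Monoid.PushoutI.lift π κ hφ (Monoid.PushoutI.base _ h))
      rw [Monoid.PushoutI.lift_base, CompactPushout.ofAlg_eq_diag]
      exact DFunLike.congr_fun hFk h
  have h2 : e (Monoid.PushoutI.lift π κ hφ x) = 1 := by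
    rw [← MonoidHom.comp_apply, ← key, MonoidHom.comp_apply, h1, map_one]
  exact hx ((Unitary.linearIsometryEquiv (𝕜 := ℝ) (H := V)).symm.injective
    (h2.trans (map_one _).symm))

variable [IsTopologicalGroup H] [CompactSpace H] [T2Space H]
  [∀ i, IsTopologicalGroup (G i)] [∀ i, CompactSpace (G i)] [∀ i, T2Space (G i)]

theorem ofAlg_base_ne_one [Finite ι] (hinj : ∀ i, Injective (φ i))
    (hnormal : ∀ i, (φ i : H →* G i).range.Normal) {K : Subgroup (ContAut H)}
    (hK : IsCompact (K : Set (ContAut H)))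
    (hGK : ∀ i, (conjAut (φ i) (hinj i) (hnormal i)).range ≤ K) {h : H} (hh : h ≠ 1) :
    CompactPushout.ofAlg φ (Monoid.PushoutI.base _ h) ≠ 1 := by
  have := Fintype.ofFinite ι
  have := ContAut.isTopologicalGroup_of_isCompact hK
  have : CompactSpace K := isCompact_iff_compactSpace.1 hK
  obtain ⟨R, hR, hRh, α, hα⟩ := exists_covariant_orthRep (ContAut.toMulAut.comp K.subtype)
    (ContAut.continuous_iff.1 continuous_subtype_val) hh
  let ad : ∀ i, G i →* K := fun i =>
    (conjAut (φ i) (hinj i) (hnormal i)).codRestrict K fun g => hGK i ⟨g, rfl⟩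
  have hext := fun i => OrthRep.exists_comap_mult_eq_mul (φ i) (hinj i)
    (c := fun g h => conjAut (φ i) (hinj i) (hnormal i) g h) (apply_conjAut _ _ _)
    (fun g => EquivLike.surjective _) R hR (α.comp (ad i)) (fun g h v => hα (ad i g) h v)
  choose N hN W hW hmult using hext
  have hdvd : ∀ i, ∃ M, ∏ j, N j = N i * M := fun i => Finset.dvd_prod_of_mem N (Finset.mem_univ i)
  choose M hM using hdvd
  let Y := R.npow (∏ j, N j)
  have heq : ∀ i, ∃ u : ((W i).npow (M i)).V ≃ₗᵢ[ℝ] Y.V,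
      ∀ h v, u (((W i).npow (M i)).ρ (φ i h) v) = Y.ρ h (u v) := fun i =>
    OrthRep.equivalent_of_mult_eq (((W i).npow (M i)).comap (φ i : H →* G i)) Y fun T hT => by
      rw [OrthRep.comap_npow, OrthRep.mult_npow, OrthRep.mult_npow, hmult i T hT, hM i]
      ring
  choose u hu using heq
  let π : ∀ i, G i →* (Y.V ≃ₗᵢ[ℝ] Y.V) := fun i =>
    { toFun := fun g => ((u i).symm.trans (((W i).npow (M i)).ρ g)).trans (u i)
      map_one' := by
        ext1 y
        change u i (((W i).npow (M i)).ρ 1 ((u i).symm y)) = y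
        rw [OrthRep.ρ_one_apply]
        exact (u i).apply_symm_apply y
      map_mul' := fun g g' => by
        ext1 y
        refine congrArg (u i) (((W i).npow (M i)).ρ_mul_apply g g' ((u i).symm y) |>.trans ?_)
        exact congrArg _ ((u i).symm_apply_apply _).symm }
  have hπφ : ∀ i, (π i).comp (φ i : H →* G i) = Y.ρ := fun i => by
    ext h y
    exact (hu i h ((u i).symm y)).trans (congrArg _ ((u i).apply_symm_apply y))
  refine ofAlg_ne_one_of_lift_ne_one π Y.ρ
    (fun i v => (u i).continuous.comp (((hW i).npow (M i)) ((u i).symm v))) (hR.npow _) hπφ ?_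
  rw [Monoid.PushoutI.lift_base]
  intro h1
  obtain ⟨y, hy⟩ := OrthRep.exists_npow_apply_ne hRh (n := ∏ j, N j)
    (Finset.prod_ne_zero_iff.2 fun i _ => hN i)
  exact hy (DFunLike.congr_fun h1 y)

end Pushout

/-! ### Words in free products of compact groups -/

section Words

theorem exists_unit_orthogonal {V : Type*} [NormedAddCommGroup V] [InnerProductSpace ℝ V] {x y : V}
    (hx : ‖x‖ = 1) (h : ∀ c : ℝ, y ≠ c • x) :
    ∃ e : V, ‖e‖ = 1 ∧ inner ℝ x e = 0 ∧ inner ℝ y e ≠ 0 := by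
  set z := y - inner ℝ x y • x with hz
  have hxz : inner ℝ x z = 0 := by
    rw [hz, inner_sub_right, inner_smul_right, real_inner_self_eq_norm_sq, hx]
    ring
  have hz0 : z ≠ 0 := fun h0 => h _ (sub_eq_zero.1 h0)
  have hyz : inner ℝ y z = inner ℝ z z := by
    have : y = z + inner ℝ x y • x := by rw [hz, sub_add_cancel]
    rw [this, inner_add_left, inner_smul_left, hxz, mul_zero, add_zero]
  refine ⟨‖z‖⁻¹ • z, norm_smul_inv_norm hz0, ?_, ?_⟩
  · rw [inner_smul_right, hxz, mul_zero]
  · rw [inner_smul_right, hyz]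
    exact mul_ne_zero (inv_ne_zero (norm_ne_zero_iff.2 hz0)) (inner_self_ne_zero.2 hz0)

/-- An element outside a closed normal subgroup moves some line in a representation that is trivial
on the subgroup. -/
theorem exists_orthRep_moving_line {G : Type*} [Group G] [TopologicalSpace G]
    [IsTopologicalGroup G] [CompactSpace G] {N : Subgroup G} [N.Normal]
    (hN : IsClosed (N : Set G)) {g : G} (hg : g ∉ N) :
    ∃ S : OrthRep G, S.IsContinuous ∧ (∀ n ∈ N, S.ρ n = 1) ∧ ∃ x e : S.V, ‖x‖ = 1 ∧ ‖e‖ = 1 ∧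
      inner ℝ x e = 0 ∧ inner ℝ (S.ρ g x) e ≠ 0 := by
  have : IsClosed (N : Set G) := hN
  obtain ⟨R, hR, v, hv⟩ := exists_orthRep_apply_ne (x := (g : G ⧸ N))
    (fun h => hg ((QuotientGroup.eq_one_iff g).1 h))
  let S : OrthRep G := (R.comap (QuotientGroup.mk' N)).prod ⟨ℝ, 1⟩
  let z : S.V := WithLp.toLp 2 (v, 1)
  have hz : z ≠ 0 := fun h => one_ne_zero (congrArg WithLp.snd h)
  have hx : ‖‖z‖⁻¹ • z‖ = 1 := norm_smul_inv_norm hz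
  obtain ⟨e, he, hxe, hge⟩ := exists_unit_orthogonal hx (y := S.ρ g (‖z‖⁻¹ • z)) fun c hc => by
    have h0 : ‖z‖⁻¹ ≠ 0 := inv_ne_zero (norm_ne_zero_iff.2 hz)
    rw [map_smul, smul_comm] at hc
    have h1 : S.ρ g z = c • z := smul_right_injective _ h0 hc
    have h2 : (1 : ℝ) = c • 1 := congrArg WithLp.snd h1
    have h3 : R.ρ g v = c • v := congrArg WithLp.fst h1
    rw [smul_eq_mul, mul_one] at h2
    rw [← h2, one_smul] at h3
    exact hv h3
  refine ⟨S, (hR.comap QuotientGroup.continuous_mk).prod fun _ => continuous_const,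
    fun n hn => ?_, _, e, hx, he, hxe, hge⟩
  have h1 : QuotientGroup.mk' N n = 1 := (QuotientGroup.eq_one_iff n).2 hn
  ext1 s
  refine congrArg (WithLp.toLp 2) (Prod.ext ?_ rfl)
  exact (congrArg (fun q => R.ρ q s.fst) h1).trans (R.ρ_one_apply _)

/-- An isometry of an orthogonal sum that exchanges two given unit vectors and fixes the vectors
orthogonal to them. -/
theorem exists_isometry_exchanging {V W : Type*} [NormedAddCommGroup V] [InnerProductSpace ℝ V]
    [NormedAddCommGroup W] [InnerProductSpace ℝ W] {e : V} {x : W} (he : ‖e‖ = 1) (hx : ‖x‖ = 1) :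
    ∃ J : WithLp 2 (V × W) ≃ₗᵢ[ℝ] WithLp 2 (V × W), J.symm = J ∧
      J (WithLp.toLp 2 (e, 0)) = WithLp.toLp 2 (0, x) ∧
      (∀ v, inner ℝ v e = 0 → J (WithLp.toLp 2 (v, 0)) = WithLp.toLp 2 (v, 0)) ∧
      ∀ y, inner ℝ x y = 0 → J (WithLp.toLp 2 (0, y)) = WithLp.toLp 2 (0, y) := by
  let a : WithLp 2 (V × W) := WithLp.toLp 2 (e, 0)
  let b : WithLp 2 (V × W) := WithLp.toLp 2 (0, x)
  have hab : ‖a‖ = ‖b‖ := by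
    rw [← sq_eq_sq₀ (norm_nonneg _) (norm_nonneg _), WithLp.prod_norm_sq_eq_of_L2,
      WithLp.prod_norm_sq_eq_of_L2]
    simp [a, b, he, hx]
  refine ⟨Submodule.reflection (Submodule.span ℝ {a - b})ᗮ, Submodule.reflection_symm,
    Submodule.reflection_sub hab, fun v hv => ?_, fun y hy => ?_⟩
  · refine Submodule.reflection_mem_subspace_eq_self ?_
    rw [Submodule.mem_orthogonal_singleton_iff_inner_left]
    simp [WithLp.prod_inner_apply, a, b, hv]
  · refine Submodule.reflection_mem_subspace_eq_self ?_
    rw [Submodule.mem_orthogonal_singleton_iff_inner_right]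
    simp [WithLp.prod_inner_apply, a, b, hy]

variable {ι : Type w} {G : ι → Type v} [∀ i, Group (G i)] [∀ i, TopologicalSpace (G i)]
  [∀ i, IsTopologicalGroup (G i)] [∀ i, CompactSpace (G i)]

/-- The product of a list of letters in the free product. -/
def letterProd (l : List (Σ i, G i)) : Monoid.CoprodI G :=
  (l.map fun p => Monoid.CoprodI.of p.2).prod

theorem exists_orthRep_coprodI (N : ∀ i, Subgroup (G i)) [∀ i, (N i).Normal]
    (hN : ∀ i, IsClosed (N i : Set (G i))) (l : List (Σ i, G i))
    (hl : l.IsChain fun p q => p.1 ≠ q.1) (hlN : ∀ p ∈ l, p.2 ∉ N p.1) :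
    ∃ R : OrthRep (Monoid.CoprodI G),
      (∀ i v, Continuous fun g : G i => R.ρ (Monoid.CoprodI.of g) v) ∧
      (∀ i, ∀ n ∈ N i, R.ρ (Monoid.CoprodI.of n) = 1) ∧
      ∃ ξ e : R.V, ‖e‖ = 1 ∧
        (∀ i, (∀ p ∈ l.head?, i ≠ p.1) → ∀ g : G i, R.ρ (Monoid.CoprodI.of g) e = e) ∧
        inner ℝ (R.ρ (letterProd l) ξ) e ≠ 0 ∧
        ∀ l', l' <:+ l → l' ≠ l → inner ℝ (R.ρ (letterProd l') ξ) e = 0 := by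
  classical
  induction l with
  | nil =>
    refine ⟨⟨ℝ, 1⟩, fun _ _ => continuous_const, fun _ _ _ => rfl, (1 : ℝ), (1 : ℝ), norm_one,
      fun _ _ _ => rfl, ?_, fun l' h1 h2 => (h2 (List.suffix_nil.1 h1)).elim⟩
    change inner ℝ (1 : ℝ) 1 ≠ 0
    simp
  | cons p l ih =>
    obtain ⟨i, q⟩ := p
    obtain ⟨R, hRc, hRN, ξ, e, he, hfix, hne, hperp⟩ :=
      ih hl.tail fun p hp => hlN p (List.mem_cons_of_mem _ hp)
    obtain ⟨S, hSc, hSN, x, y, hx, hy, hxy, hqy⟩ :=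
      exists_orthRep_moving_line (hN i) (hlN ⟨i, q⟩ List.mem_cons_self)
    obtain ⟨J, hJs, hJe, hJv, hJy⟩ := exists_isometry_exchanging (V := R.V) (W := S.V) he hx
    let σ : ∀ k, G k →* (S.V ≃ₗᵢ[ℝ] S.V) := Function.update (fun k => 1) i S.ρ
    have hσi : σ i = S.ρ := Function.update_self _ _ _
    have hσk : ∀ k, k ≠ i → σ k = 1 := fun k hk => Function.update_of_ne hk _ _
    let P : ∀ k, OrthRep (G k) := fun k =>
      (R.comap Monoid.CoprodI.of).prod ⟨S.V, σ k⟩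
    let D : ∀ k, G k →* (WithLp 2 (R.V × S.V) ≃ₗᵢ[ℝ] WithLp 2 (R.V × S.V)) := fun k => (P k).ρ
    let Jf : ι → (WithLp 2 (R.V × S.V) ≃ₗᵢ[ℝ] WithLp 2 (R.V × S.V)) := fun k =>
      if k = i then J else 1
    have hJi : Jf i = J := if_pos rfl
    have hJk : ∀ k, k ≠ i → Jf k = 1 := fun k hk => if_neg hk
    let π : ∀ k, G k →* (WithLp 2 (R.V × S.V) ≃ₗᵢ[ℝ] WithLp 2 (R.V × S.V)) := fun k =>
      (MulAut.conj (Jf k)).toMonoidHom.comp (D k)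
    let R' : OrthRep (Monoid.CoprodI G) := ⟨WithLp 2 (R.V × S.V), Monoid.CoprodI.lift π⟩
    have hR' : ∀ k (g : G k) (z : WithLp 2 (R.V × S.V)), R'.ρ (Monoid.CoprodI.of g) z =
        Jf k (D k g ((Jf k).symm z)) := fun k g z =>
      DFunLike.congr_fun (Monoid.CoprodI.lift_of (fi := π) g) z
    have hD : ∀ k (g : G k) (a : R.V) (b : S.V), D k g (WithLp.toLp 2 (a, b)) =
        WithLp.toLp 2 (R.ρ (Monoid.CoprodI.of g) a, σ k g b) := fun k g a b => rfl
    have hR'k : ∀ k, k ≠ i → ∀ (g : G k) a b, R'.ρ (Monoid.CoprodI.of g) (WithLp.toLp 2 (a, b)) =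
        WithLp.toLp 2 (R.ρ (Monoid.CoprodI.of g) a, b) := fun k hk g a b => by
      rw [hR', hJk k hk]
      change D k g (WithLp.toLp 2 (a, b)) = _
      rw [hD, hσk k hk]
      rfl
    have hfixi : ∀ g : G i, R.ρ (Monoid.CoprodI.of g) e = e := by
      refine hfix i fun p hp => ?_
      exact hl.rel_head? hp
    have hpath : ∀ l', l' <:+ l → R'.ρ (letterProd l') (WithLp.toLp 2 (ξ, 0)) =
        WithLp.toLp 2 (R.ρ (letterProd l') ξ, 0) := by
      intro l' hl'
      induction l' with
      | nil => exact (R'.ρ_one_apply _).trans (by rw [letterProd, List.map_nil, List.prod_nil,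
          OrthRep.ρ_one_apply])
      | cons p l'' ih' =>
        obtain ⟨k, g⟩ := p
        have hl'' : l'' <:+ l := (List.suffix_cons _ _).trans hl'
        have h0 := hperp l'' hl'' fun h => by
          have := hl'.length_le
          rw [← h, List.length_cons] at this
          omega
        have hcons : letterProd (⟨k, g⟩ :: l'') = Monoid.CoprodI.of g * letterProd l'' := by
          rw [letterProd, List.map_cons, List.prod_cons, letterProd]
        rw [hcons, OrthRep.ρ_mul_apply, OrthRep.ρ_mul_apply, ih' hl'']
        by_cases hk : k = i
        · subst hk
          have h1 : inner ℝ (R.ρ (Monoid.CoprodI.of g) (R.ρ (letterProd l'') ξ)) e = 0 := by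
            rw [OrthRep.inner_ρ_left, ← map_inv, hfixi, h0]
          rw [hR', hJi, hJs, hJv _ h0, hD, map_zero, hJv _ h1]
        · rw [hR'k k hk]
    refine ⟨R', fun k z => ?_, fun k n hn => ?_, WithLp.toLp 2 (ξ, 0), WithLp.toLp 2 (0, y), ?_,
      fun k hk g => ?_, ?_, fun l' h1 h2 => ?_⟩
    · simp only [hR']
      refine (Jf k).continuous.comp ?_
      have hPc : (P k).IsContinuous := by
        refine OrthRep.IsContinuous.prod (fun v => hRc k v) ?_
        by_cases hk : k = i
        · subst hk
          rw [hσi]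
          exact hSc
        · rw [hσk k hk]
          exact fun _ => continuous_const
      exact hPc _
    · have hσn : σ k n = 1 := by
        by_cases hk : k = i
        · subst hk
          rw [hσi, hSN n hn]
        · rw [hσk k hk]
          rfl
      ext1 z
      rw [hR']
      have h1 : D k n ((Jf k).symm z) = (Jf k).symm z := by
        refine (hD k n ((Jf k).symm z).fst ((Jf k).symm z).snd).trans ?_
        rw [hRN k n hn, hσn]
        rfl
      rw [h1]
      exact (Jf k).apply_symm_apply z
    · rw [← hy]
      exact WithLp.norm_toLp_snd ..
    · have hki : k ≠ i := hk ⟨i, q⟩ rfl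
      rw [hR'k k hki, map_zero]
    · have hcons : letterProd (⟨i, q⟩ :: l) = Monoid.CoprodI.of q * letterProd l := by
        rw [letterProd, List.map_cons, List.prod_cons, letterProd]
      rw [hcons, OrthRep.ρ_mul_apply, hpath l List.suffix_rfl, hR', hJi, hJs]
      set v := R.ρ (letterProd l) ξ
      have h1 : inner ℝ (v - inner ℝ v e • e) e = 0 := by
        rw [inner_sub_left, inner_smul_left, real_inner_self_eq_norm_sq, he]
        simp
      have h2 : (WithLp.toLp 2 (v, (0 : S.V)) : WithLp 2 (R.V × S.V)) =
          inner ℝ v e • WithLp.toLp 2 (e, 0) + WithLp.toLp 2 (v - inner ℝ v e • e, 0) := by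
        refine congrArg (WithLp.toLp 2) (Prod.ext ?_ ?_)
        · exact (add_sub_cancel _ _).symm
        · simp
      have h3 : J (WithLp.toLp 2 (v, 0)) =
          WithLp.toLp 2 (v - inner ℝ v e • e, inner ℝ v e • x) := by
        rw [h2, map_add, map_smul, hJe, hJv _ h1]
        refine congrArg (WithLp.toLp 2) (Prod.ext ?_ ?_)
        · simp
        · simp
      rw [h3, hD, hσi]
      have h4 : ∀ z : WithLp 2 (R.V × S.V),
          inner ℝ (J z) (WithLp.toLp 2 (0, y)) = inner ℝ z.snd y := fun z => by
        rw [← hJy y hxy, LinearIsometryEquiv.inner_map_map, WithLp.prod_inner_apply]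
        simp
      refine fun h5 => ?_
      have h6 : inner ℝ (S.ρ q (inner ℝ v e • x)) y = 0 := (h4 _).symm.trans h5
      rw [map_smul, real_inner_smul_left] at h6
      exact mul_ne_zero hne hqy h6
    · have hl' : l' <:+ l := (List.suffix_cons_iff.1 h1).resolve_left h2
      rw [hpath l' hl']
      refine (WithLp.prod_inner_apply _ _).trans ?_
      simp

end Words

section Main

theorem exists_reduced_word {ι H : Type*} {G : ι → Type*} [Group H] [∀ i, Group (G i)]
    {φ : ∀ i, H →* G i} (hφ : ∀ i, Injective (φ i))
    (x : Monoid.PushoutI φ) :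
    ∃ (h : H) (w : Monoid.CoprodI.Word G), Monoid.PushoutI.Reduced φ w ∧
      x = Monoid.PushoutI.base φ h * Monoid.PushoutI.ofCoprodI w.prod := by
  classical
  obtain ⟨d⟩ := Monoid.PushoutI.NormalWord.transversal_nonempty φ hφ
  obtain ⟨W, rfl⟩ := (Monoid.PushoutI.NormalWord.equiv (d := d)).symm.surjective x
  refine ⟨W.head, W.toWord, fun p hp hr => W.ne_one p hp ?_, rfl⟩
  have h1 := W.normalized p.1 p.2 hp
  have h2 := (d.compl p.1).1 (a₁ := (⟨p.2, hr⟩, ⟨1, d.one_mem p.1⟩)) (a₂ := (1, ⟨p.2, h1⟩))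
    (by simp)
  exact congrArg (fun a => (a.1 : G p.1)) h2

variable {ι : Type w} {H : Type u} {G : ι → Type v}
  [Group H] [TopologicalSpace H]
  [∀ i, Group (G i)] [∀ i, TopologicalSpace (G i)]
  {φ : ∀ i, H →ₜ* G i}

theorem exists_base_eq_conj (hnormal : ∀ i, (φ i : H →* G i).range.Normal) (x : AlgPushout φ)
    (h : H) : ∃ h', Monoid.PushoutI.base (fun i => (φ i : H →* G i)) h' =
      x * Monoid.PushoutI.base _ h * x⁻¹ := by
  induction x using Monoid.PushoutI.induction_on generalizing h with
  | of i g =>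
    obtain ⟨h', hh'⟩ := (hnormal i).conj_mem (φ i h) ⟨h, rfl⟩ g
    refine ⟨h', ?_⟩
    rw [← Monoid.PushoutI.of_apply_eq_base _ i, ← Monoid.PushoutI.of_apply_eq_base _ i, hh',
      map_mul, map_mul, map_inv]
    rfl
  | base k => exact ⟨k * h * k⁻¹, by simp only [map_mul, map_inv]⟩
  | mul x y ihx ihy =>
    obtain ⟨h1, hh1⟩ := ihy h
    obtain ⟨h2, hh2⟩ := ihx h1
    exact ⟨h2, by rw [hh2, hh1]; group⟩

theorem normal_range_base [CompactSpace H] (hnormal : ∀ i, (φ i : H →* G i).range.Normal) :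
    (CompactPushout.base φ : H →* CompactPushout φ).range.Normal := by
  have hclosed : IsClosed (Set.range (CompactPushout.base φ)) :=
    (isCompact_range (CompactPushout.base φ).continuous_toFun).isClosed
  have hbase : ∀ h, CompactPushout.base φ h =
      CompactPushout.ofAlg φ (Monoid.PushoutI.base _ h) := fun h => by
    rw [CompactPushout.ofAlg_eq_diag]; rfl
  refine ⟨?_⟩
  rintro _ ⟨h, rfl⟩ c
  have hcl : IsClosed {c | c * CompactPushout.base φ h * c⁻¹ ∈ Set.range (CompactPushout.base φ)} :=
    hclosed.preimage (by fun_prop)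
  refine hcl.closure_subset_iff.2 ?_ (CompactPushout.denseRange_ofAlg φ c)
  rintro _ ⟨x, rfl⟩
  obtain ⟨h', hh'⟩ := exists_base_eq_conj hnormal x h
  exact ⟨h', by rw [hbase, hbase, hh', map_mul, map_mul, map_inv]⟩

variable [CompactSpace H] [∀ i, IsTopologicalGroup (G i)] [∀ i, T2Space (G i)]

theorem ofAlg_ne_one_of_reduced [∀ i, CompactSpace (G i)]
    (hnormal : ∀ i, (φ i : H →* G i).range.Normal)
    {w : Monoid.CoprodI.Word G}
    (hw : Monoid.PushoutI.Reduced (fun i => (φ i : H →* G i)) w) (hne : w.toList ≠ []) (h : H) :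
    CompactPushout.ofAlg φ (Monoid.PushoutI.base _ h * Monoid.PushoutI.ofCoprodI w.prod) ≠ 1 := by
  obtain ⟨R, hRc, hRN, ξ, e, -, -, h1, h2⟩ := exists_orthRep_coprodI
    (fun i => (φ i : H →* G i).range)
    (fun i => (isCompact_range (φ i).continuous_toFun).isClosed) w.toList w.chain_ne hw
  have hφ1 : ∀ i, (R.ρ.comp Monoid.CoprodI.of).comp (φ i : H →* G i) = 1 := fun i =>
    MonoidHom.ext fun h => hRN i _ ⟨h, rfl⟩
  refine ofAlg_ne_one_of_lift_ne_one (fun i => R.ρ.comp Monoid.CoprodI.of) 1 hRc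
    (fun _ => continuous_const) hφ1 fun hx => h1 ?_
  have hcomp : (Monoid.PushoutI.lift (fun i => R.ρ.comp Monoid.CoprodI.of) 1 hφ1).comp
      Monoid.PushoutI.ofCoprodI = R.ρ := by
    refine Monoid.CoprodI.ext_hom _ _ fun i => MonoidHom.ext fun g => ?_
    rw [MonoidHom.comp_apply, MonoidHom.comp_apply, Monoid.PushoutI.ofCoprodI_of,
      Monoid.PushoutI.lift_of]
  rw [map_mul, Monoid.PushoutI.lift_base, MonoidHom.one_apply, one_mul, ← MonoidHom.comp_apply,
    hcomp] at hx
  have h3 : R.ρ (letterProd w.toList) = 1 := hx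
  have h4 := h2 [] List.nil_suffix hne.symm
  have h5 : R.ρ (letterProd ([] : List (Σ i, G i))) = 1 := map_one _
  rw [h5] at h4
  rw [h3, h4]

variable [IsTopologicalGroup H] [T2Space H]

theorem algebraicallySound_of_isCompact [Finite ι] [∀ i, CompactSpace (G i)]
    (hinj : ∀ i, Injective (φ i))
    (hnormal : ∀ i, (φ i : H →* G i).range.Normal) {K : Subgroup (ContAut H)}
    (hK : IsCompact (K : Set (ContAut H)))
    (hGK : ∀ i, (conjAut (φ i) (hinj i) (hnormal i)).range ≤ K) : AlgebraicallySound φ := by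
  refine (injective_iff_map_eq_one _).2 fun x hx => ?_
  obtain ⟨h, w, hw, rfl⟩ := exists_reduced_word (φ := fun i => (φ i : H →* G i)) hinj x
  by_cases hne : w.toList = []
  · have hw1 : w.prod = 1 := by
      rw [Monoid.CoprodI.Word.prod, hne, List.map_nil, List.prod_nil]
    rw [hw1, map_one, mul_one] at hx ⊢
    by_contra hh
    exact ofAlg_base_ne_one hinj hnormal hK hGK
      (fun h0 => hh (by rw [h0, map_one])) hx
  · exact (ofAlg_ne_one_of_reduced hnormal hw hne h hx).elim

theorem continuous_conjAut {H G : Type*} [Group H] [TopologicalSpace H] [IsTopologicalGroup H]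
    [CompactSpace H] [T2Space H] [Group G] [TopologicalSpace G] [IsTopologicalGroup G] [T2Space G]
    (φ : H →ₜ* G) (hinj : Injective φ) (hnormal : (φ : H →* G).range.Normal) :
    Continuous (conjAut φ hinj hnormal) := by
  rw [ContAut.continuous_iff, (φ.continuous_toFun.isClosedEmbedding hinj).isInducing.continuous_iff]
  refine Continuous.congr ?_ fun p => (apply_conjAut φ hinj hnormal p.1 p.2).symm
  exact (continuous_fst.mul (φ.continuous_toFun.comp continuous_snd)).mul continuous_fst.inv

theorem exists_compact_of_algebraicallySound (hinj : ∀ i, Injective (φ i))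
    (hnormal : ∀ i, (φ i : H →* G i).range.Normal) (hsound : AlgebraicallySound φ) :
    ∃ K : Subgroup (ContAut H), IsCompact (K : Set (ContAut H)) ∧
      ∀ i, (conjAut (φ i) (hinj i) (hnormal i)).range ≤ K := by
  have hb : Injective (CompactPushout.base φ) := fun h h' hh => by
    refine Monoid.PushoutI.base_injective (φ := fun i => (φ i : H →* G i)) hinj (hsound ?_)
    rw [CompactPushout.ofAlg_eq_diag]
    exact hh
  have hn := normal_range_base hnormal
  refine ⟨(conjAut (CompactPushout.base φ) hb hn).range, ?_, fun i => ?_⟩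
  · exact isCompact_range (continuous_conjAut (CompactPushout.base φ) hb hn)
  · rintro _ ⟨g, rfl⟩
    refine ⟨CompactPushout.of φ i g, ContAut.ext fun h => hb ?_⟩
    have hof : ∀ k, CompactPushout.base φ k = CompactPushout.of φ i (φ i k) := fun k =>
      (DFunLike.congr_fun (CompactPushout.of_comp φ i) k).symm
    rw [apply_conjAut, hof, hof, apply_conjAut, map_mul, map_mul, map_inv]

end Main

theorem mainTheorem4 {ι : Type w} [Finite ι] {H : Type u} {G : ι → Type v}
    [Group H] [TopologicalSpace H] [IsTopologicalGroup H] [CompactSpace H] [T2Space H]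
    [∀ i, Group (G i)] [∀ i, TopologicalSpace (G i)] [∀ i, IsTopologicalGroup (G i)]
    [∀ i, CompactSpace (G i)] [∀ i, T2Space (G i)]
    (φ : ∀ i, H →ₜ* G i) (hinj : ∀ i, Injective (φ i))
    (hnormal : ∀ i, (φ i : H →* G i).range.Normal) :
    (AlgebraicallySound φ ↔
      ∃ K : Subgroup (ContAut H), IsCompact (K : Set (ContAut H)) ∧
        ∀ i, (conjAut (φ i) (hinj i) (hnormal i)).range ≤ K) ∧
    (CompactSpace (ContAut H) → AlgebraicallySound φ) := by
  refine ⟨⟨exists_compact_of_algebraicallySound hinj hnormal, ?_⟩, fun hcomp => ?_⟩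
  · rintro ⟨K, hK, hGK⟩
    exact algebraicallySound_of_isCompact hinj hnormal hK hGK
  · exact algebraicallySound_of_isCompact (K := ⊤) hinj hnormal isCompact_univ fun _ => le_top
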